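/- Let $A=(a_{ij})_{i,j\in I}$ be a Cartan matrix, with the convention $[h_i,e_j]=a_{ij}e_j$, so that the Serre relations read $(\mathrm{ad}\,e_i)^{1-a_{ij}}(e_j)=0$, and let $\mathfrak g$ be the corresponding complex Lie algebra with Chevalley generators $e_i,f_i$, $i\in I$. Let $\mathbf b=(b_{ij})$ be a family of complex numbers with $b_{ij}=b_{ji}$, attached to the edges $\{i,j\}$ of the Dynkin diagram. Denote by $\mathfrak g^{(\mathbf b)}$ the complex Lie algebra generated by $u_i$, $i\in I$, subject to the relations $$(\mathrm{ad}\,u_i)^{1-a_{ij}}(u_j)+2\,\delta_{a_{ij},-1}\,b_{ij}\,u_i=0\qquad\text{for all distinct } i,j\in I .$$ **Theorem.** Let $n\ge 1$ and $I=\{1,\dots,n\}$, where $i$ and $i+1$ are adjacent in the Dynkin diagram for $1\le i<n$. (a) Let $\mathfrak g=so_{2n+1}$, where the short simple root is $\alpha_n$ (so that $a_{n-1,n}=-1$, $a_{n,n-1}=-2$ if $n\ge2$). Then for every $\mathbf b$ the assignments $$u_1\mapsto e_1,\qquad u_i\mapsto e_i+b_{i-1,i}f_{i-1}\quad (2\le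 i\le n)$$ define an injective homomorphism of Lie algebras $so_{2n+1}^{(\mathbf b)}\hookrightarrow so_{2n+1}$. (b) Let $\mathfrak g=sp_{2n}$, where the long simple root is $\alpha_n$ (so that $a_{n-1,n}=-2$, $a_{n,n-1}=-1$ if $n\ge2$). Given $\mathbf b$, put $c_i=b_{i-1,i}$ for $2\le i<n$ and, if $n\ge2$, $c_n=\tfrac12 b_{n,n-1}$. Then the assignments $$u_1\mapsto e_1,\qquad u_i\mapsto e_i+c_if_{i-1}-\delta_{i,n}\,\tfrac12\,c_n^2\,[f_{n-1},[f_{n-1},f_n]]\quad(2\le i\le n)$$ define an injective homomorphism of Lie algebras $sp_{2n}^{(\mathbf b)}\hookrightarrow sp_{2n}$. -/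

import Mathlib

namespace ElectricalLie

open Matrix

section EdgeType

variable {I : Type} (A : Matrix I I ℤ) (b : I → I → ℂ)

/-- The left-hand side `(ad u_i)^(1 - a_ij) (u_j) + 2 δ_{a_ij, -1} b_ij u_i` of the deformed Serre
relation, as an element of the free Lie algebra on the letters `u_i`, `i ∈ I`.
(For `i ≠ j` the entry `a_ij` of a Cartan matrix is non-positive, so `toNat` is harmless.) -/
noncomputable def edgeRelator (i j : I) : FreeLieAlgebra ℂ I :=
  ((LieAlgebra.ad ℂ (FreeLieAlgebra ℂ I) (FreeLieAlgebra.of ℂ i)) ^ (1 - A i j).toNat)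
      (FreeLieAlgebra.of ℂ j) +
    if A i j = -1 then (2 * b i j) • FreeLieAlgebra.of ℂ i else 0

/-- The Lie ideal generated by the deformed Serre relations for all distinct `i, j`. -/
noncomputable def edgeIdeal : LieIdeal ℂ (FreeLieAlgebra ℂ I) :=
  LieSubmodule.lieSpan ℂ (FreeLieAlgebra ℂ I) {x | ∃ i j, i ≠ j ∧ x = edgeRelator A b i j}

/-- The generalized electrical Lie algebra of edge type `A` with parameters `b`: generators
`u_i`, `i ∈ I`, subject to the deformed Serre relations. -/
abbrev EdgeAlgebra : Type := FreeLieAlgebra ℂ I ⧸ edgeIdeal A b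

/-- The generator `u_i`. -/
noncomputable def EdgeAlgebra.u (i : I) : EdgeAlgebra A b :=
  LieSubmodule.Quotient.mk (FreeLieAlgebra.of ℂ i)

end EdgeType

section Cartan

/-- The Cartan matrix `a_ij = α_j(h_i)` of `so_{2n+1}`, with simple roots numbered so that the
last one is short: `a_{n,n-1} = -2`, `a_{n-1,n} = -1`.  (Mathlib's matrix `CartanMatrix.B n` has
entries `α_i(h_j)`.) -/
def cartanB (n : ℕ) : Matrix (Fin n) (Fin n) ℤ := (CartanMatrix.B n)ᵀ

/-- The Cartan matrix `a_ij = α_j(h_i)` of `sp_{2n}`, with simple roots numbered so that the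
last one is long: `a_{n-1,n} = -2`, `a_{n,n-1} = -1`.  (Mathlib's matrix `CartanMatrix.C n` has
entries `α_i(h_j)`.) -/
def cartanC (n : ℕ) : Matrix (Fin n) (Fin n) ℤ := (CartanMatrix.C n)ᵀ

end Cartan

section Odd

/-- The index of the basis vector `v_0` of `ℂ^{2n+1}`. The bilinear form that `typeB` preserves is
`(v_0, v_0) = 2`, `(v_i, w_i) = (w_i, v_i) = 1`, and `0` on all other pairs of basis vectors. -/
abbrev B0 (n : ℕ) : Unit ⊕ (Fin n ⊕ Fin n) := Sum.inl ()
/-- The index of the basis vector `v_i` of `ℂ^{2n+1}`. -/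
abbrev Bv {n : ℕ} (i : Fin n) : Unit ⊕ (Fin n ⊕ Fin n) := Sum.inr (Sum.inl i)
/-- The index of the basis vector `w_i` of `ℂ^{2n+1}`. -/
abbrev Bw {n : ℕ} (i : Fin n) : Unit ⊕ (Fin n ⊕ Fin n) := Sum.inr (Sum.inr i)

/-- The matrix of the Chevalley generator `e_i` of `so_{2n+1}`: a root vector for
`ε_i - ε_{i+1}` if `i` is not last, and for the short root `ε_n` if it is. -/
def soEMatrix {n : ℕ} (i : Fin n) :
    Matrix (Unit ⊕ (Fin n ⊕ Fin n)) (Unit ⊕ (Fin n ⊕ Fin n)) ℂ :=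
  if h : i.val + 1 < n then
    Matrix.single (Bv i) (Bv ⟨i.val + 1, h⟩) 1 - Matrix.single (Bw ⟨i.val + 1, h⟩) (Bw i) 1
  else Matrix.single (Bv i) (B0 n) 2 - Matrix.single (B0 n) (Bw i) 1

/-- The matrix of the Chevalley generator `f_i` of `so_{2n+1}`. -/
def soFMatrix {n : ℕ} (i : Fin n) :
    Matrix (Unit ⊕ (Fin n ⊕ Fin n)) (Unit ⊕ (Fin n ⊕ Fin n)) ℂ :=
  if h : i.val + 1 < n then
    Matrix.single (Bv ⟨i.val + 1, h⟩) (Bv i) 1 - Matrix.single (Bw i) (Bw ⟨i.val + 1, h⟩) 1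
  else Matrix.single (B0 n) (Bv i) 1 - Matrix.single (Bw i) (B0 n) 2

theorem soEMatrix_mem {n : ℕ} (i : Fin n) :
    soEMatrix i ∈ LieAlgebra.Orthogonal.typeB (Fin n) ℂ := by
  rw [LieAlgebra.Orthogonal.typeB, mem_skewAdjointMatricesLieSubalgebra,
    mem_skewAdjointMatricesSubmodule]
  unfold Matrix.IsSkewAdjoint Matrix.IsAdjointPair soEMatrix
  split_ifs with h <;> ext (x | x | x) (y | y | y) <;>
    simp [LieAlgebra.Orthogonal.JB, LieAlgebra.Orthogonal.JD, Matrix.mul_apply, Matrix.single_apply,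
      Matrix.one_apply, ite_and] <;> grind

theorem soFMatrix_mem {n : ℕ} (i : Fin n) :
    soFMatrix i ∈ LieAlgebra.Orthogonal.typeB (Fin n) ℂ := by
  rw [LieAlgebra.Orthogonal.typeB, mem_skewAdjointMatricesLieSubalgebra,
    mem_skewAdjointMatricesSubmodule]
  unfold Matrix.IsSkewAdjoint Matrix.IsAdjointPair soFMatrix
  split_ifs with h <;> ext (x | x | x) (y | y | y) <;>
    simp [LieAlgebra.Orthogonal.JB, LieAlgebra.Orthogonal.JD, Matrix.mul_apply, Matrix.single_apply,
      Matrix.one_apply, ite_and] <;> grind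

/-- The Chevalley generator `e_i` of `so_{2n+1}`. -/
def soE {n : ℕ} (i : Fin n) : LieAlgebra.Orthogonal.typeB (Fin n) ℂ :=
  ⟨soEMatrix i, soEMatrix_mem i⟩

/-- The Chevalley generator `f_i` of `so_{2n+1}`. -/
def soF {n : ℕ} (i : Fin n) : LieAlgebra.Orthogonal.typeB (Fin n) ℂ :=
  ⟨soFMatrix i, soFMatrix_mem i⟩

end Odd

section Symplectic

/-- The matrix of the Chevalley generator `e_i` of `sp_{2n}` in the basis `v_i = inl i`,
`w_i = inr i` of `ℂ^{2n}`: a root vector for `ε_i - ε_{i+1}` if `i` is not last, and for the long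
root `2 ε_n` if it is. -/
def spEMatrix {n : ℕ} (i : Fin n) : Matrix (Fin n ⊕ Fin n) (Fin n ⊕ Fin n) ℂ :=
  if h : i.val + 1 < n then
    Matrix.single (Sum.inl i) (Sum.inl ⟨i.val + 1, h⟩) 1 -
      Matrix.single (Sum.inr ⟨i.val + 1, h⟩) (Sum.inr i) 1
  else Matrix.single (Sum.inl i) (Sum.inr i) 1

/-- The matrix of the Chevalley generator `f_i` of `sp_{2n}`. -/
def spFMatrix {n : ℕ} (i : Fin n) : Matrix (Fin n ⊕ Fin n) (Fin n ⊕ Fin n) ℂ :=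
  if h : i.val + 1 < n then
    Matrix.single (Sum.inl ⟨i.val + 1, h⟩) (Sum.inl i) 1 -
      Matrix.single (Sum.inr i) (Sum.inr ⟨i.val + 1, h⟩) 1
  else Matrix.single (Sum.inr i) (Sum.inl i) 1

theorem spEMatrix_mem {n : ℕ} (i : Fin n) :
    spEMatrix i ∈ LieAlgebra.Symplectic.sp (Fin n) ℂ := by
  rw [LieAlgebra.Symplectic.sp, mem_skewAdjointMatricesLieSubalgebra,
    mem_skewAdjointMatricesSubmodule]
  unfold Matrix.IsSkewAdjoint Matrix.IsAdjointPair spEMatrix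
  split_ifs with h <;> ext (x | x) (y | y) <;>
    simp [Matrix.J, Matrix.mul_apply, Matrix.single_apply,
      Matrix.one_apply, ite_and] <;> grind

theorem spFMatrix_mem {n : ℕ} (i : Fin n) :
    spFMatrix i ∈ LieAlgebra.Symplectic.sp (Fin n) ℂ := by
  rw [LieAlgebra.Symplectic.sp, mem_skewAdjointMatricesLieSubalgebra,
    mem_skewAdjointMatricesSubmodule]
  unfold Matrix.IsSkewAdjoint Matrix.IsAdjointPair spFMatrix
  split_ifs with h <;> ext (x | x) (y | y) <;>
    simp [Matrix.J, Matrix.mul_apply, Matrix.single_apply,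
      Matrix.one_apply, ite_and] <;> grind

/-- The Chevalley generator `e_i` of `sp_{2n}`. -/
def spE {n : ℕ} (i : Fin n) : LieAlgebra.Symplectic.sp (Fin n) ℂ :=
  ⟨spEMatrix i, spEMatrix_mem i⟩

/-- The Chevalley generator `f_i` of `sp_{2n}`. -/
def spF {n : ℕ} (i : Fin n) : LieAlgebra.Symplectic.sp (Fin n) ℂ :=
  ⟨spFMatrix i, spFMatrix_mem i⟩

end Symplectic

end ElectricalLie

set_option linter.unusedSimpArgs false

namespace ElectricalLie

attribute [local instance 100] LieRing.ofAssociativeRing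

/-! ### Serre relations acting on a module, and the chain grown from a lowest weight vector -/

section LieModule

variable {L N : Type*} [LieRing L] [LieAlgebra ℂ L] [AddCommGroup N] [Module ℂ N]
  [LieRingModule L N] [LieModule ℂ L N]

/-! The homomorphisms exist because the proposed images satisfy the relations, an identity between
matrix units. Injectivity is proved by induction on the rank, removing the first node.

Let `u 0, …, u (l + 1)` generate L and satisfy the relations, and let T be the subalgebra generated
by `u 1, u 2, …`. In L/T the class of `u 0` is killed by `u 2, u 3, …`. Bracketing it with `u 1`, `u
2`, … up to the last generator and then back again gives a chain that imitates the vector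
representation of the smaller algebra. The Serre relations, read as operator identities, force each
generator of T to send each chain member to a multiple of a chain member. Hence T and the chain,
enlarged in type C by one highest element, span a subspace stable under T. It turns out to be stable
under `u 0` as well, so it is L (`RelB.sup_span_chainB`, `RelC.sup_span_chainC`).

In the matrix representation the row `v_1` and the column `w_1` vanish on T. In the order `v_1, …,
v_n, (v_0,) w_n, …, w_1` the generators have no entries above the first superdiagonal, so the rows
`v_1` of the chain elements have distinct last nonzero positions and are independent. An element of
the kernel therefore lies in T. On T, deleting `v_1` and `w_1` gives the representation of the same
shape in rank one less (`injective_of_tail`), and induction applies. -/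

omit [LieAlgebra ℂ L] [Module ℂ N] [LieModule ℂ L N] in
theorem lie_lie_of_commute {x y : L} (h : ⁅x, y⁆ = 0) (n : N) : ⁅x, ⁅y, n⁆⁆ = ⁅y, ⁅x, n⁆⁆ := by
  have := lie_lie x y n
  rw [h, zero_lie] at this
  exact (sub_eq_zero.mp this.symm)

/-- Iterated brackets act as combinations of words in the operators of `x` and `y`. The chain
computations apply this identity, or `cubic_relation`, to vectors that kill most of the words. -/
theorem quadratic_relation {x y : L} {c : ℂ} (h : ⁅x, ⁅x, y⁆⁆ = c • x) (n : N) :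
    ⁅x, ⁅x, ⁅y, n⁆⁆⁆ - (2 : ℂ) • ⁅x, ⁅y, ⁅x, n⁆⁆⁆ + ⁅y, ⁅x, ⁅x, n⁆⁆⁆ = c • ⁅x, n⁆ := by
  rw [← smul_lie c x n, ← h]
  simp only [lie_lie, lie_sub]
  module

omit [LieAlgebra ℂ L] [LieModule ℂ L N] in
theorem cubic_relation {x y : L} (h : ⁅x, ⁅x, ⁅x, y⁆⁆⁆ = 0) (n : N) :
    ⁅x, ⁅x, ⁅x, ⁅y, n⁆⁆⁆⁆ - (3 : ℂ) • ⁅x, ⁅x, ⁅y, ⁅x, n⁆⁆⁆⁆ + (3 : ℂ) • ⁅x, ⁅y, ⁅x, ⁅x, n⁆⁆⁆⁆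
      - ⁅y, ⁅x, ⁅x, ⁅x, n⁆⁆⁆⁆ = 0 := by
  rw [← zero_lie (L := L) n, ← h]
  simp only [lie_lie, lie_sub]
  module

/-- The deformed Serre relations of type `A` among `u 0, …, u l`, without those that involve the
last edge `{l - 1, l}`. -/
structure RelA (l : ℕ) (β : ℕ → ℂ) (u : ℕ → L) : Prop where
  comm : ∀ i j, i + 2 ≤ j → j ≤ l → ⁅u i, u j⁆ = 0
  up : ∀ i, i + 2 ≤ l → ⁅u i, ⁅u i, u (i + 1)⁆⁆ = (-(2 * β i)) • u i
  down : ∀ i, i + 2 ≤ l → ⁅u (i + 1), ⁅u (i + 1), u i⁆⁆ = (-(2 * β i)) • u (i + 1)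

/-- The deformed Serre relations of type `B` among `u 0, …, u l`. -/
structure RelB (l : ℕ) (β : ℕ → ℂ) (u : ℕ → L) : Prop extends RelA l β u where
  up_last : ∀ i, i + 1 = l → ⁅u i, ⁅u i, u (i + 1)⁆⁆ = (-(2 * β i)) • u i
  cube : ∀ i, i + 1 = l → ⁅u (i + 1), ⁅u (i + 1), ⁅u (i + 1), u i⁆⁆⁆ = 0

/-- The deformed Serre relations of type `C` among `u 0, …, u l`. -/
structure RelC (l : ℕ) (β : ℕ → ℂ) (u : ℕ → L) : Prop extends RelA l β u where
  down_last : ∀ i, i + 1 = l → ⁅u (i + 1), ⁅u (i + 1), u i⁆⁆ = (-(2 * β i)) • u (i + 1)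
  cube : ∀ i, i + 1 = l → ⁅u i, ⁅u i, ⁅u i, u (i + 1)⁆⁆⁆ = 0

theorem RelA.shift {l : ℕ} {β : ℕ → ℂ} {u : ℕ → L} (h : RelA (l + 1) β u) :
    RelA l (fun i => β (i + 1)) (fun i => u (i + 1)) where
  comm i j hij hj := h.comm _ _ (by omega) (by omega)
  up i hi := h.up _ (by omega)
  down i hi := h.down _ (by omega)

theorem RelB.shift {l : ℕ} {β : ℕ → ℂ} {u : ℕ → L} (h : RelB (l + 1) β u) :
    RelB l (fun i => β (i + 1)) (fun i => u (i + 1)) where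
  toRelA := h.toRelA.shift
  up_last i hi := h.up_last _ (by omega)
  cube i hi := h.cube _ (by omega)

theorem RelC.shift {l : ℕ} {β : ℕ → ℂ} {u : ℕ → L} (h : RelC (l + 1) β u) :
    RelC l (fun i => β (i + 1)) (fun i => u (i + 1)) where
  toRelA := h.toRelA.shift
  down_last i hi := h.down_last _ (by omega)
  cube i hi := h.cube _ (by omega)

variable {l : ℕ} {β : ℕ → ℂ} {u : ℕ → L} {y z : ℕ → N}

theorem lie_lie_middle {x w : L} {b : ℂ} (h : ⁅x, ⁅x, w⁆⁆ = (-(2 * b)) • x) {n : N}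
    (h₁ : ⁅x, ⁅x, ⁅w, n⁆⁆⁆ = 0) (h₂ : ⁅x, ⁅x, n⁆⁆ = 0) : ⁅x, ⁅w, ⁅x, n⁆⁆⁆ = b • ⁅x, n⁆ := by
  have := quadratic_relation h n
  rw [h₁, h₂, lie_zero] at this
  refine smul_right_injective N (two_ne_zero' ℂ) ?_
  dsimp only
  linear_combination (norm := module) -this

theorem lie_lie_eq_zero {x w : L} {c : ℂ} (h : ⁅x, ⁅x, w⁆⁆ = c • x) {n : N} (h₁ : ⁅x, n⁆ = 0) :
    ⁅x, ⁅x, ⁅w, n⁆⁆⁆ = 0 := by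
  simpa [h₁] using quadratic_relation h n

/-- The ascending half of the chain obtained from a lowest weight vector `y 0`. -/
structure AscendingChain (l : ℕ) (u : ℕ → L) (y : ℕ → N) : Prop where
  lowest : ∀ j, 1 ≤ j → j ≤ l → ⁅u j, y 0⁆ = 0
  step : ∀ k, k < l → y (k + 1) = ⁅u k, y k⁆
  first : 1 ≤ l → ⁅u 0, y 1⁆ = 0

namespace AscendingChain

omit [Module ℂ N] [LieModule ℂ L N] in
theorem lie_of_lt (hy : AscendingChain l u y) (hu : RelA l β u) {i k : ℕ} (hki : k < i)
    (hi : i ≤ l) : ⁅u i, y k⁆ = 0 := by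
  induction k with
  | zero => exact hy.lowest i hki hi
  | succ k ih =>
    rw [hy.step k (by omega), ← lie_lie_of_commute (hu.comm k i (by omega) hi), ih (by omega),
      lie_zero]

theorem lie_succ (hy : AscendingChain l u y) (hu : RelA l β u) {i : ℕ} (hi : i + 1 ≤ l) :
    ⁅u i, y (i + 1)⁆ = 0 := by
  cases i with
  | zero => exact hy.first hi
  | succ i =>
    rw [hy.step (i + 1) (by omega), hy.step i (by omega)]
    exact lie_lie_eq_zero (hu.down i (by omega)) (hy.lie_of_lt hu (by omega) (by omega))

/-- In the quadratic relation at `y i`, both `u (i + 1)` and the square of `u i` kill `y i`, so only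
the middle word survives. The vector is written `⁅u (i + 1), y (i + 1)⁆` because for `i + 1 = l` it
lies beyond the ascending half. -/
theorem lie_add_two_of (hy : AscendingChain l u y) (hu : RelA l β u) {i : ℕ} (hi : i + 1 ≤ l)
    (hup : ⁅u i, ⁅u i, u (i + 1)⁆⁆ = (-(2 * β i)) • u i) :
    ⁅u i, ⁅u (i + 1), y (i + 1)⁆⁆ = β i • y (i + 1) := by
  rw [hy.step i (by omega)]
  refine lie_lie_middle hup ?_ ?_
  · rw [hy.lie_of_lt hu (by omega) (by omega), lie_zero, lie_zero]
  · rw [← hy.step i (by omega), hy.lie_succ hu hi]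

theorem lie_add_two (hy : AscendingChain l u y) (hu : RelA l β u) {i : ℕ} (hi : i + 2 ≤ l) :
    ⁅u i, y (i + 2)⁆ = β i • y (i + 1) := by
  rw [hy.step (i + 1) (by omega)]
  exact hy.lie_add_two_of hu (by omega) (hu.up i hi)

/-- `u i` commutes past `u k` down to `k = i + 2`, where it produces a multiple of `y (i + 1)`,
which `u (i + 2)` kills. The case `k = l` controls the point where the chain turns. -/
theorem lie_add_three_aux (hy : AscendingChain l u y) (hu : RelA l β u) {i k : ℕ}
    (hk : i + 2 ≤ k) (hkl : k ≤ l) : ⁅u i, ⁅u k, y k⁆⁆ = 0 := by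
  induction k, hk using Nat.le_induction with
  | base =>
    rw [lie_lie_of_commute (hu.comm _ _ (by omega) hkl), hy.lie_add_two hu hkl, lie_smul,
      hy.lie_of_lt hu (by omega) hkl, smul_zero]
  | succ k hk ih =>
    rw [lie_lie_of_commute (hu.comm _ _ (by omega) hkl), hy.step k (by omega), ih (by omega),
      lie_zero]

theorem lie_add_three (hy : AscendingChain l u y) (hu : RelA l β u) {i k : ℕ}
    (hk : i + 3 ≤ k) (hkl : k ≤ l) : ⁅u i, y k⁆ = 0 := by
  obtain ⟨k, rfl⟩ : ∃ k', k = k' + 1 := ⟨k - 1, by omega⟩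
  rw [hy.step k (by omega)]
  exact hy.lie_add_three_aux hu (by omega) (by omega)

end AscendingChain

/-- The descending half `z l, …, z 0` of the chain, with the part of the action that depends on
how the two halves are glued together. -/
structure DescendingChain (l : ℕ) (β : ℕ → ℂ) (u : ℕ → L) (z : ℕ → N) : Prop where
  step : ∀ k, k < l → z k = ⁅u k, z (k + 1)⁆
  top_far : ∀ i, i + 2 ≤ l → ⁅u i, z l⁆ = 0
  top : ⁅u l, z l⁆ = 0
  next : ∀ i, i + 1 = l → ⁅u i, z i⁆ = 0
  top_back : ∀ i, i + 1 = l → ⁅u (i + 1), z i⁆ = β i • z (i + 1)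

namespace DescendingChain

omit [LieModule ℂ L N] in
theorem lie_of_lt (hz : DescendingChain l β u z) (hu : RelA l β u) {i k : ℕ} (hik : i + 2 ≤ k)
    (hk : k ≤ l) : ⁅u i, z k⁆ = 0 := by
  induction hk using Nat.decreasingInduction with
  | self => exact hz.top_far i hik
  | of_succ k hk ih =>
    rw [hz.step k hk, lie_lie_of_commute (hu.comm i k hik hk.le), ih (by omega), lie_zero]

theorem lie_self (hz : DescendingChain l β u z) (hu : RelA l β u) {i : ℕ} (hi : i ≤ l) :
    ⁅u i, z i⁆ = 0 := by
  rcases (by omega : i = l ∨ i + 1 = l ∨ i + 2 ≤ l) with rfl | h | h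
  · exact hz.top
  · exact hz.next i h
  · rw [hz.step i (by omega), hz.step (i + 1) (by omega)]
    exact lie_lie_eq_zero (hu.up i h) (hz.lie_of_lt hu (by omega) h)

theorem lie_succ (hz : DescendingChain l β u z) (hu : RelA l β u) {i : ℕ} (hi : i + 1 ≤ l) :
    ⁅u (i + 1), z i⁆ = β i • z (i + 1) := by
  rcases (by omega : i + 1 = l ∨ i + 2 ≤ l) with h | h
  · exact hz.top_back i h
  · rw [hz.step i (by omega), hz.step (i + 1) (by omega)]
    refine lie_lie_middle (hu.down i h) ?_ ?_
    · rw [hz.lie_of_lt hu (by omega) h, lie_zero, lie_zero]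
    · rw [← hz.step (i + 1) (by omega), hz.lie_self hu hi]

/-- `u i` commutes past `u k`, and `k` rises until `i = k + 2`. There `u i` turns `z (k + 1)` into a
multiple of `z i`, which `u k` kills. -/
theorem lie_of_gt (hz : DescendingChain l β u z) (hu : RelA l β u) {i k : ℕ} (hik : k + 2 ≤ i)
    (hi : i ≤ l) : ⁅u i, z k⁆ = 0 := by
  have hk : k + 2 ≤ i := hik
  revert hik
  induction (show k ≤ i by omega) using Nat.decreasingInduction with
  | self => omega
  | of_succ k hk' ih =>
    intro hik
    rw [hz.step k (by omega), ← lie_lie_of_commute (hu.comm k i hik hi)]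
    rcases (by omega : i = k + 2 ∨ k + 1 + 2 ≤ i) with rfl | h
    · rw [hz.lie_succ hu hi, lie_smul, hz.lie_of_lt hu le_rfl hi, smul_zero]
    · rw [ih (by omega) h, lie_zero]

end DescendingChain

theorem RelB.lie_y_last {y : ℕ → N} (hu : RelB l β u) (hy : AscendingChain l u y) {i : ℕ}
    (hi : i + 1 = l) : ⁅u i, ⁅u l, y l⁆⁆ = β i • y l := by
  subst hi
  exact hy.lie_add_two_of hu.toRelA le_rfl (hu.up_last i rfl)

/-- In type B the chain turns through an extra vector `⁅u l, y l⁆`, in the role of `v_0`, so `u l`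
acts twice before the descent. For `l = 0` no edge is available, and the vanishing at the top is
supplied by `h0`. -/
theorem RelB.descendingChain (hu : RelB l β u) (hy : AscendingChain l u y)
    (h0 : l = 0 → ⁅u 0, ⁅u 0, ⁅u 0, y 0⁆⁆⁆ = 0)
    (hl : z l = ⁅u l, ⁅u l, y l⁆⁆) (hz : ∀ k, k < l → z k = ⁅u k, z (k + 1)⁆) :
    DescendingChain l β u z := by
  have htop : ⁅u l, z l⁆ = 0 := by
    rw [hl]
    cases l with
    | zero => exact h0 rfl
    | succ i =>
      have := cubic_relation (hu.cube i rfl) (y i)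
      rw [hy.lie_of_lt hu.toRelA (Nat.lt_succ_self i) le_rfl] at this
      simpa [hy.step i (by omega)] using this
  refine ⟨hz, ?_, htop, ?_, ?_⟩
  · intro i hi
    rw [hl, lie_lie_of_commute (hu.comm i l hi le_rfl),
      hy.lie_add_three_aux hu.toRelA hi le_rfl, lie_zero]
  · rintro i rfl
    rw [hz i (by omega), hl]
    -- Since `u i` sends this vector to `β i • y (i + 1)`, the middle word equals the right-hand
    -- side and cancels it.
    have := quadratic_relation (hu.up_last i rfl) ⁅u (i + 1), y (i + 1)⁆
    simp only [hu.lie_y_last hy rfl, lie_smul, hy.lie_succ hu.toRelA le_rfl, smul_zero,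
      lie_zero] at this
    linear_combination (norm := module) this
  · rintro i rfl
    rw [hz i (by omega)]
    have h₃ : ⁅u (i + 1), ⁅u (i + 1), ⁅u (i + 1), y (i + 1)⁆⁆⁆ = 0 := by rw [← hl, htop]
    -- The two outer words vanish, and what remains is three times the claim.
    have := cubic_relation (hu.cube i rfl) (y (i + 1))
    rw [hy.lie_succ hu.toRelA le_rfl, hu.lie_y_last hy rfl, h₃] at this
    rw [hl]
    refine smul_right_injective N (three_ne_zero' ℂ) ?_
    simp only [lie_smul, lie_zero] at this
    dsimp only
    linear_combination (norm := module) this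

/-- In type C `u l` acts only once at the turn, as from `v_n` to `w_n`. Its quadratic relation stops
the chain there, and the cubic relation of the preceding generator gives `next`. -/
theorem RelC.descendingChain (hu : RelC l β u) (hy : AscendingChain l u y)
    (h0 : l = 0 → ⁅u 0, ⁅u 0, y 0⁆⁆ = 0)
    (hl : z l = ⁅u l, y l⁆) (hz : ∀ k, k < l → z k = ⁅u k, z (k + 1)⁆) :
    DescendingChain l β u z := by
  have htop : ⁅u l, z l⁆ = 0 := by
    rw [hl]
    cases l with
    | zero => exact h0 rfl
    | succ i =>
      rw [hy.step i (by omega)]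
      exact lie_lie_eq_zero (hu.down_last i rfl)
        (hy.lie_of_lt hu.toRelA (Nat.lt_succ_self i) le_rfl)
  refine ⟨hz, ?_, htop, ?_, ?_⟩
  · intro i hi
    rw [hl, hy.lie_add_three_aux hu.toRelA hi le_rfl]
  · rintro i rfl
    have h₁ := hy.lie_of_lt hu.toRelA (Nat.lt_succ_self i) le_rfl
    have h₂ : ⁅u i, ⁅u i, y i⁆⁆ = 0 := by
      rw [← hy.step i (by omega), hy.lie_succ hu.toRelA le_rfl]
    have := cubic_relation (hu.cube i rfl) (y i)
    rw [hz i (by omega), hl, hy.step i (by omega)]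
    rw [h₁, h₂] at this
    simpa using this
  · rintro i rfl
    rw [hz i (by omega), hl]
    refine lie_lie_middle (hu.down_last i rfl) ?_ ?_
    · rw [hy.lie_succ hu.toRelA le_rfl, lie_zero, lie_zero]
    · rw [← hl, htop]

end LieModule

/-! ### The subalgebra without the first generator, and the chain of `u 0` modulo it -/

section Tail

variable {L : Type*} [LieRing L] [LieAlgebra ℂ L]

theorem lie_mem_of_mem_lieSpan {S : Set L} {P : Submodule ℂ L}
    (h : ∀ g ∈ S, ∀ x ∈ P, ⁅g, x⁆ ∈ P) {g : L} (hg : g ∈ LieSubalgebra.lieSpan ℂ L S) :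
    ∀ x ∈ P, ⁅g, x⁆ ∈ P := by
  induction hg using LieSubalgebra.lieSpan_induction with
  | mem g hg => exact h g hg
  | zero => intro x _; simp
  | add g g' _ _ hg hg' => intro x hx; rw [add_lie]; exact P.add_mem (hg x hx) (hg' x hx)
  | smul a g _ hg => intro x hx; rw [smul_lie]; exact P.smul_mem a (hg x hx)
  | lie g g' _ _ hg hg' =>
    intro x hx
    rw [lie_lie]
    exact P.sub_mem (hg _ (hg' x hx)) (hg' _ (hg x hx))

/-- The elements that stabilise `P` form a subalgebra containing `S`, so all of `L` stabilises `P`.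
Then `P` is itself a subalgebra containing `S`. -/
theorem eq_top_of_lie_mem {S : Set L} (hS : LieSubalgebra.lieSpan ℂ L S = ⊤) {P : Submodule ℂ L}
    (hSP : S ⊆ P) (h : ∀ g ∈ S, ∀ x ∈ P, ⁅g, x⁆ ∈ P) : P = ⊤ := by
  let Q : LieSubalgebra ℂ L :=
    { P with
      lie_mem' := fun {x y} _ hy =>
        lie_mem_of_mem_lieSpan h (by rw [hS]; exact LieSubalgebra.mem_top x) y hy }
  have hQ : LieSubalgebra.lieSpan ℂ L S ≤ Q := LieSubalgebra.lieSpan_le.mpr hSP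
  rw [hS] at hQ
  exact eq_top_iff.mpr fun x _ => hQ (LieSubalgebra.mem_top x)

/-- The subalgebra generated by `u 1, u 2, …`. -/
abbrev tail (u : ℕ → L) : LieSubalgebra ℂ L :=
  LieSubalgebra.lieSpan ℂ L (Set.range fun i => u (i + 1))

/-- The generators of `tail u`. -/
def tailGen (u : ℕ → L) (i : ℕ) : tail u :=
  ⟨u (i + 1), LieSubalgebra.subset_lieSpan ⟨i, rfl⟩⟩

@[simp]
theorem coe_tailGen (u : ℕ → L) (i : ℕ) : (tailGen u i : L) = u (i + 1) := rfl

theorem lieSpan_range_tailGen (u : ℕ → L) :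
    LieSubalgebra.lieSpan ℂ (tail u) (Set.range (tailGen u)) = ⊤ := by
  rw [← LieSubalgebra.lieSpan_lieSpan_coe_preimage (R := ℂ)
    (s := Set.range fun i => u (i + 1))]
  congr 1
  ext x
  simp [Subtype.ext_iff]

/-- The projection of `L` to its quotient by `tail u`, as `tail u`-modules. -/
def tailProj (u : ℕ → L) : L →ₗ⁅ℂ, tail u⁆ L ⧸ (tail u).toLieSubmodule :=
  LieSubmodule.Quotient.mk' (tail u).toLieSubmodule

theorem tailProj_eq_zero {u : ℕ → L} {x : L} : tailProj u x = 0 ↔ x ∈ tail u :=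
  LieSubmodule.Quotient.mk_eq_zero _

theorem tailProj_lie (u : ℕ → L) (i : ℕ) (x : L) :
    tailProj u ⁅u (i + 1), x⁆ = ⁅tailGen u i, tailProj u x⁆ :=
  (tailProj u).map_lie (tailGen u i) x

theorem mem_of_tailProj_eq {u : ℕ → L} {P : Submodule ℂ L} (hP : (tail u).toSubmodule ≤ P)
    {x x' : L} (h : tailProj u x = tailProj u x') (hx' : x' ∈ P) : x ∈ P := by
  have : x - x' ∈ tail u := by rw [← tailProj_eq_zero, map_sub, h, sub_self]
  simpa using P.add_mem (hP this) hx'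

variable {l : ℕ} {β : ℕ → ℂ} {u : ℕ → L}

theorem RelA.tail_rel (h : RelA (l + 1) β u) :
    RelA l (fun i => β (i + 1)) (tailGen u) where
  comm i j hij hj := Subtype.ext (h.shift.comm i j hij hj)
  up i hi := Subtype.ext (h.shift.up i hi)
  down i hi := Subtype.ext (h.shift.down i hi)

theorem RelB.tail_rel (h : RelB (l + 1) β u) :
    RelB l (fun i => β (i + 1)) (tailGen u) where
  toRelA := h.toRelA.tail_rel
  up_last i hi := Subtype.ext (h.shift.up_last i hi)
  cube i hi := Subtype.ext (h.shift.cube i hi)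

theorem RelC.tail_rel (h : RelC (l + 1) β u) :
    RelC l (fun i => β (i + 1)) (tailGen u) where
  toRelA := h.toRelA.tail_rel
  down_last i hi := Subtype.ext (h.shift.down_last i hi)
  cube i hi := Subtype.ext (h.shift.cube i hi)

/-- The ascending chain `u 0, ⁅u 1, u 0⁆, ⁅u 2, ⁅u 1, u 0⁆⁆, …`. -/
def ascend (u : ℕ → L) : ℕ → L
  | 0 => u 0
  | k + 1 => ⁅u (k + 1), ascend u k⁆

/-- The `k`-th member of the descending chain
`⁅u (l + 1), t⁆, ⁅u l, ⁅u (l + 1), t⁆⁆, …`, numbered downwards from `l`. -/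
def descend (l : ℕ) (u : ℕ → L) (t : L) (k : ℕ) : L :=
  (List.range' (k + 1) (l + 1 - k)).foldr (fun i x => ⁅u i, x⁆) t

omit [LieAlgebra ℂ L] in
theorem descend_top (t : L) : descend l u t l = ⁅u (l + 1), t⁆ := by
  simp [descend]

omit [LieAlgebra ℂ L] in
theorem descend_of_lt (t : L) {k : ℕ} (hk : k < l) :
    descend l u t k = ⁅u (k + 1), descend l u t (k + 1)⁆ := by
  rw [descend, descend, show l + 1 - k = (l + 1 - (k + 1)) + 1 by omega, List.range'_succ,
    List.foldr_cons]

/-- The passage to the quotient is what makes `u 0` a lowest weight vector of a chain: `⁅u 1, ⁅u 1,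
u 0⁆⁆` is only a multiple of `u 1`, which is zero modulo `tail u`. -/
theorem RelA.ascendingChain (h : RelA (l + 1) β u) :
    AscendingChain l (tailGen u) (fun k => tailProj u (ascend u k)) where
  lowest j hj hjl := by
    rw [← tailProj_lie, ascend, ← lie_skew, h.comm 0 (j + 1) (by omega) (by omega), neg_zero,
      map_zero]
  step k _ := tailProj_lie u k _
  first hl := by
    rw [← tailProj_lie, ascend, ascend, h.down 0 (by omega), tailProj_eq_zero]
    exact (tail u).smul_mem _ (tailGen u 0).2

theorem RelB.descend_isDescendingChain (h : RelB (l + 1) β u) :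
    DescendingChain l (fun i => β (i + 1)) (tailGen u)
      (fun k => tailProj u (descend l u (ascend u (l + 1)) k)) := by
  refine h.tail_rel.descendingChain h.toRelA.ascendingChain ?_ ?_ ?_
  · rintro rfl
    simp only [← tailProj_lie, ascend]
    rw [h.cube 0 rfl, map_zero]
  · simp only [descend_top, tailProj_lie, ascend]
  · intro k hk
    simp only [descend_of_lt _ hk, tailProj_lie]

theorem RelC.descend_isDescendingChain (h : RelC (l + 1) β u) :
    DescendingChain l (fun i => β (i + 1)) (tailGen u)
      (fun k => tailProj u (descend l u (ascend u l) k)) := by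
  refine h.tail_rel.descendingChain h.toRelA.ascendingChain ?_ ?_ ?_
  · rintro rfl
    simp only [← tailProj_lie, ascend]
    rw [h.down_last 0 rfl, tailProj_eq_zero]
    exact (tail u).smul_mem _ (tailGen u 0).2
  · simp only [descend_top, tailProj_lie]
  · intro k hk
    simp only [descend_of_lt _ hk, tailProj_lie]

/-- The element `ascend u (l + 1)` has its own hypothesis because it ends the ascending half in type
B but begins the descending half in type C. -/
theorem RelA.lie_ascend_mem (h : RelA (l + 1) β u) {P : Submodule ℂ L}
    (hP : (tail u).toSubmodule ≤ P) (hy : ∀ k ≤ l, ascend u k ∈ P) (hy' : ascend u (l + 1) ∈ P)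
    {i k : ℕ} (hi : i ≤ l) (hk : k ≤ l) : ⁅u (i + 1), ascend u k⁆ ∈ P := by
  have c := h.ascendingChain
  rcases (by omega : k < i ∨ k = i ∨ k = i + 1 ∨ k = i + 2 ∨ i + 3 ≤ k) with
    hik | rfl | rfl | rfl | hik
  · refine mem_of_tailProj_eq hP (x' := 0) ?_ P.zero_mem
    rw [tailProj_lie, c.lie_of_lt h.tail_rel hik hi, map_zero]
  · rcases hi.lt_or_eq with hi | rfl
    · exact hy (k + 1) hi
    · exact hy'
  · refine mem_of_tailProj_eq hP (x' := 0) ?_ P.zero_mem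
    rw [tailProj_lie, c.lie_succ h.tail_rel hk, map_zero]
  · refine mem_of_tailProj_eq hP (x' := β (i + 1) • ascend u (i + 1)) ?_
      (P.smul_mem _ (hy _ (by omega)))
    rw [tailProj_lie, c.lie_add_two h.tail_rel hk, map_smul]
  · refine mem_of_tailProj_eq hP (x' := 0) ?_ P.zero_mem
    rw [tailProj_lie, c.lie_add_three h.tail_rel hik hk, map_zero]

theorem RelA.lie_descend_mem (h : RelA (l + 1) β u) {z : ℕ → L}
    (c : DescendingChain l (fun i => β (i + 1)) (tailGen u)
      (fun k => tailProj u (z k)))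
    {P : Submodule ℂ L} (hP : (tail u).toSubmodule ≤ P) (hz : ∀ k ≤ l, z k ∈ P)
    {i k : ℕ} (hi : i ≤ l) (hk : k ≤ l) : ⁅u (i + 1), z k⁆ ∈ P := by
  rcases (by omega : i + 2 ≤ k ∨ k = i + 1 ∨ k = i ∨ i = k + 1 ∨ k + 2 ≤ i) with
    hik | rfl | rfl | rfl | hik
  · refine mem_of_tailProj_eq hP (x' := 0) ?_ P.zero_mem
    rw [tailProj_lie, c.lie_of_lt h.tail_rel hik hk, map_zero]
  · refine mem_of_tailProj_eq hP (x' := z i) ?_ (hz _ hi)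
    rw [tailProj_lie, c.step i (by omega)]
  · refine mem_of_tailProj_eq hP (x' := 0) ?_ P.zero_mem
    rw [tailProj_lie, c.lie_self h.tail_rel hi, map_zero]
  · refine mem_of_tailProj_eq hP (x' := β (k + 1) • z (k + 1)) ?_ (P.smul_mem _ (hz _ hi))
    rw [tailProj_lie, c.lie_succ h.tail_rel hi, map_smul]
  · refine mem_of_tailProj_eq hP (x' := 0) ?_ P.zero_mem
    rw [tailProj_lie, c.lie_of_gt h.tail_rel hik hi, map_zero]

theorem lie_mem_sup_span {K : LieSubalgebra ℂ L} {S : Set L} {P : Submodule ℂ L} {g : L}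
    (hK : ∀ x ∈ K, ⁅g, x⁆ ∈ P) (hS : ∀ x ∈ S, ⁅g, x⁆ ∈ P) :
    ∀ x ∈ K.toSubmodule ⊔ Submodule.span ℂ S, ⁅g, x⁆ ∈ P := by
  have : K.toSubmodule ⊔ Submodule.span ℂ S ≤ P.comap (LieAlgebra.ad ℂ L g : L →ₗ[ℂ] L) :=
    sup_le hK (Submodule.span_le.mpr hS)
  exact this

/-- `u 0` commutes past `u 2, u 3, …`, so everything comes from `⁅u 0, ⁅u 1, u 0⁆⁆`. This is a
multiple of `u 0`, which the next generator kills. -/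
theorem RelA.lie_zero_ascend (h : RelA (l + 1) β u)
    (hup : ⁅u 0, ⁅u 0, u 1⁆⁆ = (-(2 * β 0)) • u 0) {k : ℕ} (hk : k ≤ l) :
    ⁅u 0, ascend u (k + 1)⁆ = (if k = 0 then 2 * β 0 else 0) • u 0 := by
  induction k with
  | zero => rw [ascend, ascend, ← lie_skew (u (0 + 1)), lie_neg, if_pos rfl, zero_add, hup,
      neg_smul, neg_neg]
  | succ k ih =>
    rw [ascend, lie_lie_of_commute (h.comm 0 _ (by omega) (by omega)), ih (by omega), lie_smul,
      ← lie_skew, h.comm 0 _ (by omega) (by omega), neg_zero, smul_zero, if_neg (by omega),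
      zero_smul]

theorem RelA.lie_zero_descend (h : RelA (l + 1) β u) {t : L} {b : ℂ}
    (ht : 1 ≤ l → ⁅u 0, t⁆ = b • u 0) {k : ℕ} (hk : k ≤ l) (hk' : 1 ≤ k) :
    ⁅u 0, descend l u t k⁆ = 0 := by
  induction hk using Nat.decreasingInduction with
  | self =>
    rw [descend_top, lie_lie_of_commute (h.comm 0 _ (by omega) (by omega)), ht hk', lie_smul,
      ← lie_skew, h.comm 0 _ (by omega) (by omega), neg_zero, smul_zero]
  | of_succ k hk ih =>
    rw [descend_of_lt _ hk, lie_lie_of_commute (h.comm 0 _ (by omega) (by omega)), ih (by omega),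
      lie_zero]

end Tail

/-! ### The tail and the chain span the whole algebra -/

section Generation

variable {L : Type*} [LieRing L] [LieAlgebra ℂ L] {l : ℕ} {β : ℕ → ℂ} {u : ℕ → L}

/-- The basis of a complement of `tail u`, in type `B`. -/
def chainB (l : ℕ) (u : ℕ → L) : Fin (l + 2) ⊕ Fin (l + 1) → L :=
  Sum.elim (fun k => ascend u k) (fun k => descend l u (ascend u (l + 1)) k)

/-- The basis of a complement of `tail u`, in type `C`. -/
def chainC (l : ℕ) (u : ℕ → L) : Unit ⊕ (Fin (l + 1) ⊕ Fin (l + 1)) → L :=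
  Sum.elim (fun _ => ⁅u 0, descend l u (ascend u l) 0⁆)
    (Sum.elim (fun k => ascend u k) (fun k => descend l u (ascend u l) k))

theorem RelB.lie_mem_sup_span_chainB (h : RelB (l + 1) β u) (hvan : ∀ i, l + 2 ≤ i → u i = 0)
    {P : Submodule ℂ L}
    (hP : P = (tail u).toSubmodule ⊔ Submodule.span ℂ (Set.range (chainB l u))) :
    ∀ g ∈ Set.range (fun i => u (i + 1)), ∀ x ∈ P, ⁅g, x⁆ ∈ P := by
  have hT : (tail u).toSubmodule ≤ P := hP ▸ le_sup_left
  have hS : ∀ k, chainB l u k ∈ P := fun k =>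
    hP ▸ Submodule.mem_sup_right (Submodule.subset_span ⟨k, rfl⟩)
  have hy : ∀ k ≤ l + 1, ascend u k ∈ P := fun k hk => hS (Sum.inl ⟨k, by omega⟩)
  have hz : ∀ k ≤ l, descend l u (ascend u (l + 1)) k ∈ P :=
    fun k hk => hS (Sum.inr ⟨k, by omega⟩)
  rintro _ ⟨i, rfl⟩
  dsimp only
  rcases Nat.lt_or_ge l i with hi | hi
  · intro x _
    rw [hvan (i + 1) (by omega), zero_lie]
    exact P.zero_mem
  · have key : ∀ x ∈ (tail u).toSubmodule ⊔ Submodule.span ℂ (Set.range (chainB l u)),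
        ⁅u (i + 1), x⁆ ∈ P := by
      refine lie_mem_sup_span (fun x hx => hT ((tail u).lie_mem (tailGen u i).2 hx)) ?_
      rintro _ ⟨k | k, rfl⟩
      · have hk := k.2
        rcases (by omega : (k : ℕ) ≤ l ∨ (k : ℕ) = l + 1) with hk | hk
        · exact h.lie_ascend_mem hT (fun k hk => hy k (by omega)) (hy _ le_rfl) hi hk
        · simp only [chainB, Sum.elim_inl, hk]
          rcases (by omega : i = l ∨ i + 1 = l ∨ i + 2 ≤ l) with rfl | hi | hi
          · rw [← descend_top]
            exact hz _ le_rfl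
          · refine mem_of_tailProj_eq hT (x' := β (i + 1) • ascend u l) ?_
              (P.smul_mem _ (hy _ (by omega)))
            rw [tailProj_lie, ascend, tailProj_lie, h.tail_rel.lie_y_last h.ascendingChain hi,
              map_smul]
          · refine mem_of_tailProj_eq hT (x' := 0) ?_ P.zero_mem
            rw [tailProj_lie, ascend, tailProj_lie,
              h.ascendingChain.lie_add_three_aux h.toRelA.tail_rel hi le_rfl, map_zero]
      · exact h.lie_descend_mem h.descend_isDescendingChain hT hz hi (by omega)
    exact hP ▸ key

theorem RelB.up_zero (h : RelB (l + 1) β u) : ⁅u 0, ⁅u 0, u 1⁆⁆ = (-(2 * β 0)) • u 0 := by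
  rcases Nat.eq_zero_or_pos l with rfl | hl
  · exact h.up_last 0 rfl
  · exact h.up 0 (by omega)

/-- By the Jacobi identity, `⁅y k, z k⁆` equals `-⁅y (k + 1), z (k + 1)⁆` modulo `P`, where `y k` is
`ascend u k`. So the bracket can be pushed along the chain to `k = l`, where `z l = ⁅u (l + 1), y (l
+ 1)⁆` leaves only `⁅y l, y (l + 1)⁆` and a bracket of `y (l + 1)` with itself. The same shifting
brings the off-diagonal brackets down to those with `u 0`. -/
theorem RelB.lie_zero_top_mem (h : RelB (l + 1) β u)
    (hvan : ∀ i, l + 2 ≤ i → u i = 0) {P : Submodule ℂ L}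
    (hP : P = (tail u).toSubmodule ⊔ Submodule.span ℂ (Set.range (chainB l u)))
    (h0 : ∀ g ∈ tail u, ∀ x ∈ P, ⁅x, g⁆ ∈ P) :
    ⁅ascend u 0, descend l u (ascend u (l + 1)) 0⁆ ∈ P := by
  set z := descend l u (ascend u (l + 1)) with hzdef
  have hT : (tail u).toSubmodule ≤ P := hP ▸ le_sup_left
  have hS : ∀ k, chainB l u k ∈ P := fun k =>
    hP ▸ Submodule.mem_sup_right (Submodule.subset_span ⟨k, rfl⟩)
  have hy : ∀ k ≤ l + 1, ascend u k ∈ P := fun k hk => hS (Sum.inl ⟨k, by omega⟩)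
  have hg : ∀ i x, x ∈ P → ⁅u (i + 1), x⁆ ∈ P := fun i =>
    h.lie_mem_sup_span_chainB hvan hP _ ⟨i, rfl⟩
  have cz := h.descend_isDescendingChain
  have cy := h.ascendingChain
  have hr := h.toRelA.tail_rel
  -- move one step of the chain across the bracket
  have move : ∀ (k : ℕ) (x : L), ⁅ascend u (k + 1), x⁆ =
      ⁅u (k + 1), ⁅ascend u k, x⁆⁆ - ⁅ascend u k, ⁅u (k + 1), x⁆⁆ := fun k x => by
    rw [ascend, lie_lie]
  have hyy : ∀ k j, k < j → j ≤ l + 1 → ⁅ascend u k, ascend u j⁆ ∈ P := by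
    intro k
    induction k with
    | zero =>
      intro j hj hjl
      obtain ⟨j, rfl⟩ : ∃ i, j = i + 1 := ⟨j - 1, by omega⟩
      rw [show ascend u 0 = u 0 from rfl, h.lie_zero_ascend h.up_zero (by omega)]
      exact P.smul_mem _ (hy 0 (by omega))
    | succ k ih =>
      intro j hj hjl
      rw [move]
      refine P.sub_mem (hg _ _ (ih j (by omega) hjl)) ?_
      -- The difference from `c • ascend u (k + 1)` lies in the tail and is covered by `h0`; the
      -- multiple itself is covered by the induction hypothesis.
      have of_tail : ∀ c : ℂ, tailProj u ⁅u (k + 1), ascend u j⁆ = c • tailProj u (ascend u (k + 1)) →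
          ⁅ascend u k, ⁅u (k + 1), ascend u j⁆⁆ ∈ P := by
        intro c hc
        have hc : ⁅u (k + 1), ascend u j⁆ - c • ascend u (k + 1) ∈ tail u := by
          rw [← tailProj_eq_zero, map_sub, map_smul, hc, sub_self]
        have := P.add_mem (h0 _ hc _ (hy k (by omega)))
          (P.smul_mem c (ih (k + 1) (by omega) (by omega)))
        rwa [← lie_smul, ← lie_add, sub_add_cancel] at this
      rcases (by omega : j = k + 2 ∨ k + 3 ≤ j) with rfl | hj
      · refine of_tail (β (k + 1)) ?_
        rcases (by omega : k + 2 ≤ l ∨ k + 1 = l) with hk | hk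
        · rw [tailProj_lie, cy.lie_add_two hr hk]
        · subst hk
          rw [tailProj_lie, ascend, tailProj_lie, h.tail_rel.lie_y_last cy rfl]
      · refine of_tail 0 ?_
        obtain ⟨j, rfl⟩ : ∃ i, j = i + 1 := ⟨j - 1, by omega⟩
        rw [ascend, tailProj_lie, tailProj_lie,
          cy.lie_add_three_aux hr (by omega) (by omega), zero_smul]
  have hyz : ∀ k j, k < j → j ≤ l → ⁅ascend u k, z j⁆ ∈ P := by
    intro k
    induction k with
    | zero =>
      intro j hj hjl
      rw [show ascend u 0 = u 0 from rfl, hzdef, h.lie_zero_descend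
        (fun _ => h.lie_zero_ascend h.up_zero le_rfl) hjl hj]
      exact P.zero_mem
    | succ k ih =>
      intro j hj hjl
      rw [move]
      refine P.sub_mem (hg _ _ (ih j (by omega) hjl)) (h0 _ ?_ _ (hy k (by omega)))
      rw [← tailProj_eq_zero, tailProj_lie, cz.lie_of_lt hr (by omega) hjl]
  have move' : ∀ (k : ℕ) (x : L), ⁅ascend u k, ⁅u (k + 1), x⁆⁆ =
      ⁅u (k + 1), ⁅ascend u k, x⁆⁆ - ⁅ascend u (k + 1), x⁆ := fun k x => by
    rw [move, sub_sub_cancel]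
  have hdiag : ∀ k, k ≤ l → ⁅ascend u k, z k⁆ ∈ P := by
    intro k hk
    induction hk using Nat.decreasingInduction with
    | self =>
      rw [hzdef, descend_top, move', lie_self, sub_zero]
      exact hg _ _ (hyy l (l + 1) (by omega) le_rfl)
    | of_succ k hk ih =>
      rw [hzdef, descend_of_lt _ hk, move']
      exact P.sub_mem (hg _ _ (hyz k (k + 1) (by omega) hk)) ih
  exact hdiag 0 (by omega)

theorem RelB.sup_span_chainB (h : RelB (l + 1) β u) (hvan : ∀ i, l + 2 ≤ i → u i = 0)
    (hgen : LieSubalgebra.lieSpan ℂ L (Set.range u) = ⊤) :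
    (tail u).toSubmodule ⊔ Submodule.span ℂ (Set.range (chainB l u)) = ⊤ := by
  obtain ⟨P, hP⟩ : ∃ P, P = (tail u).toSubmodule ⊔ Submodule.span ℂ (Set.range (chainB l u)) :=
    ⟨_, rfl⟩
  rw [← hP]
  have hT : (tail u).toSubmodule ≤ P := hP ▸ le_sup_left
  have hS : ∀ k, chainB l u k ∈ P := fun k =>
    hP ▸ Submodule.mem_sup_right (Submodule.subset_span ⟨k, rfl⟩)
  have hst := h.lie_mem_sup_span_chainB hvan hP
  have hst' : ∀ g ∈ tail u, ∀ x ∈ P, ⁅x, g⁆ ∈ P := fun g hg x hx => by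
    rw [← lie_skew]
    exact P.neg_mem (lie_mem_of_mem_lieSpan hst hg x hx)
  have hu : u 0 ∈ P := hS (Sum.inl 0)
  refine eq_top_of_lie_mem hgen ?_ ?_
  · rintro _ ⟨_ | i, rfl⟩
    · exact hu
    · exact hT (tailGen u i).2
  · rintro _ ⟨_ | i, rfl⟩
    · intro x hx
      rw [hP] at hx
      refine lie_mem_sup_span (fun g hg => hst' g hg _ hu) ?_ x hx
      rintro _ ⟨⟨k, hk⟩ | ⟨k, hk⟩, rfl⟩
      · cases k with
        | zero => simp [chainB, ascend]
        | succ k =>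
          simp only [chainB, Sum.elim_inl]
          rw [h.lie_zero_ascend h.up_zero (by omega)]
          exact P.smul_mem _ hu
      · cases k with
        | zero => exact h.lie_zero_top_mem hvan hP hst'
        | succ k =>
          simp only [chainB, Sum.elim_inr]
          rw [h.lie_zero_descend (fun _ => h.lie_zero_ascend h.up_zero le_rfl) (by omega)
            (by omega)]
          exact P.zero_mem
    · exact hst _ ⟨i, rfl⟩

/-- In type `C`, `tail u` and the chain without its highest member span a `tail u`-submodule. -/
theorem RelC.lie_mem_sup_span_chain (h : RelC (l + 1) β u) (hvan : ∀ i, l + 2 ≤ i → u i = 0)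
    {P : Submodule ℂ L}
    (hP : P = (tail u).toSubmodule ⊔
      Submodule.span ℂ (Set.range fun k => chainC l u (Sum.inr k))) :
    ∀ g ∈ Set.range (fun i => u (i + 1)), ∀ x ∈ P, ⁅g, x⁆ ∈ P := by
  have hT : (tail u).toSubmodule ≤ P := hP ▸ le_sup_left
  have hS : ∀ k, chainC l u (Sum.inr k) ∈ P := fun k =>
    hP ▸ Submodule.mem_sup_right (Submodule.subset_span ⟨k, rfl⟩)
  have hy : ∀ k ≤ l, ascend u k ∈ P := fun k hk => hS (Sum.inl ⟨k, by omega⟩)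
  have hz : ∀ k ≤ l, descend l u (ascend u l) k ∈ P :=
    fun k hk => hS (Sum.inr ⟨k, by omega⟩)
  rintro _ ⟨i, rfl⟩
  dsimp only
  rcases Nat.lt_or_ge l i with hi | hi
  · intro x _
    rw [hvan (i + 1) (by omega), zero_lie]
    exact P.zero_mem
  · have key : ∀ x ∈ (tail u).toSubmodule ⊔
        Submodule.span ℂ (Set.range fun k => chainC l u (Sum.inr k)), ⁅u (i + 1), x⁆ ∈ P := by
      refine lie_mem_sup_span (fun x hx => hT ((tail u).lie_mem (tailGen u i).2 hx)) ?_
      rintro _ ⟨k | k, rfl⟩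
      · refine h.lie_ascend_mem hT hy ?_ hi (by omega)
        rw [ascend, ← descend_top]
        exact hz _ le_rfl
      · exact h.lie_descend_mem h.descend_isDescendingChain hT hz hi (by omega)
    exact hP ▸ key

/-- The only spanning vector that `u 0` can carry out of `P` is `z 0`, and it goes to `w`. It
remains to see that the generators of the tail send `w` into `P` and that `u 0` kills it. -/
theorem RelC.sup_span_chainC (h : RelC (l + 1) β u) (hvan : ∀ i, l + 2 ≤ i → u i = 0)
    (hgen : LieSubalgebra.lieSpan ℂ L (Set.range u) = ⊤) :
    (tail u).toSubmodule ⊔ Submodule.span ℂ (Set.range (chainC l u)) = ⊤ := by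
  obtain ⟨P, hP⟩ : ∃ P, P = (tail u).toSubmodule ⊔
      Submodule.span ℂ (Set.range fun k => chainC l u (Sum.inr k)) := ⟨_, rfl⟩
  obtain ⟨Q, hQ⟩ : ∃ Q, Q = (tail u).toSubmodule ⊔ Submodule.span ℂ (Set.range (chainC l u)) :=
    ⟨_, rfl⟩
  rw [← hQ]
  have hT : (tail u).toSubmodule ≤ P := hP ▸ le_sup_left
  have hS : ∀ k, chainC l u (Sum.inr k) ∈ P := fun k =>
    hP ▸ Submodule.mem_sup_right (Submodule.subset_span ⟨k, rfl⟩)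
  have hPQ : P ≤ Q := by
    rw [hP, hQ]
    refine sup_le_sup_left (Submodule.span_mono ?_) _
    rintro _ ⟨k, rfl⟩
    exact ⟨_, rfl⟩
  have hst := h.lie_mem_sup_span_chain hvan hP
  have hst' : ∀ g ∈ tail u, ∀ x ∈ P, ⁅x, g⁆ ∈ P := fun g hg x hx => by
    rw [← lie_skew]
    exact P.neg_mem (lie_mem_of_mem_lieSpan hst hg x hx)
  have hu : u 0 ∈ P := hS (Sum.inl 0)
  set z := descend l u (ascend u l) with hzdef
  set w := ⁅u 0, z 0⁆ with hwdef
  have hz : ∀ k ≤ l, z k ∈ P := fun k hk => hS (Sum.inr ⟨k, by omega⟩)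
  have hw : w ∈ Q := hQ ▸ Submodule.mem_sup_right (Submodule.subset_span ⟨Sum.inl (), rfl⟩)
  have cz := h.descend_isDescendingChain
  have hr := h.toRelA.tail_rel
  have hup : 1 ≤ l → ⁅u 0, ⁅u 0, u 1⁆⁆ = (-(2 * β 0)) • u 0 := fun hl => h.up 0 (by omega)
  have htop : 1 ≤ l → ⁅u 0, ascend u l⁆ = (if l - 1 = 0 then 2 * β 0 else 0) • u 0 := fun hl => by
    obtain ⟨k, rfl⟩ : ∃ k, l = k + 1 := ⟨l - 1, by omega⟩
    exact h.lie_zero_ascend (hup hl) (by omega)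
  have hzz : ∀ k, 1 ≤ k → k ≤ l → ⁅u 0, z k⁆ = 0 := fun k hk hkl => by
    rw [hzdef, h.lie_zero_descend htop hkl hk]
  have hwu : ∀ i, ⁅u (i + 1), w⁆ ∈ P := by
    intro i
    rcases Nat.lt_or_ge l i with hi | hi
    · rw [hvan (i + 1) (by omega), zero_lie]
      exact P.zero_mem
    have hu_lie : ∀ i ≤ l, ⁅u 0, ⁅u (i + 1), z 0⁆⁆ ∈ P := by
      intro i hi
      rcases (by omega : i = 0 ∨ i = 1 ∨ 2 ≤ i) with rfl | rfl | hi'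
      · refine hst' _ ?_ _ hu
        rw [← tailProj_eq_zero, tailProj_lie, cz.lie_self hr hi]
      · have : ⁅u 2, z 0⁆ - β 1 • z 1 ∈ tail u := by
          rw [← tailProj_eq_zero, map_sub, tailProj_lie, cz.lie_succ hr hi, map_smul, sub_self]
        have := hst' _ this _ hu
        rwa [lie_sub, lie_smul, hzz 1 le_rfl hi, smul_zero, sub_zero] at this
      · refine hst' _ ?_ _ hu
        rw [← tailProj_eq_zero, tailProj_lie, cz.lie_of_gt hr hi' hi]
    rw [hwdef, leibniz_lie]
    refine P.add_mem ?_ (hu_lie i hi)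
    rcases i with _ | i
    · rcases Nat.eq_zero_or_pos l with rfl | hl
      · rw [hzdef, descend_top, ascend, lie_self]
        exact P.zero_mem
      · have hz0 : z 0 = ⁅u 1, z 1⁆ := by rw [hzdef, descend_of_lt _ hl]
        -- `h₂` expresses `⁅⁅u 1, u 0⁆, z 0⁆` through `⁅u 1, w⁆`, and `h₄` expresses `⁅u 1, w⁆`
        -- through it again with the opposite sign. Solving for it in `h₅` divides by 2.
        have h₁ : ⁅⁅u 1, u 0⁆, z 1⁆ = - w := by
          rw [lie_lie, hzz 1 le_rfl hl, lie_zero, zero_sub, ← hz0]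
        have h₂ : ⁅⁅u 1, u 0⁆, z 0⁆ = ⁅u 1, ⁅⁅u 1, u 0⁆, z 1⁆⁆ - ⁅⁅u 1, ⁅u 1, u 0⁆⁆, z 1⁆ := by
          rw [lie_lie (u 1) ⁅u 1, u 0⁆, hz0, sub_sub_cancel]
        have h₃ : ⁅⁅u 1, ⁅u 1, u 0⁆⁆, z 1⁆ ∈ P := by
          rw [h.down 0 (by omega), smul_lie]
          exact P.smul_mem _ (hst _ ⟨0, rfl⟩ _ (hz 1 hl))
        have h₄ : ⁅u 1, w⁆ = ⁅⁅u 1, u 0⁆, z 0⁆ + ⁅u 0, ⁅u 1, z 0⁆⁆ := by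
          rw [hwdef, leibniz_lie]
        rw [h₁, lie_neg, h₄] at h₂
        have h₅ : ⁅⁅u 1, u 0⁆, z 0⁆ = (-(1 / 2) : ℂ) •
            (⁅u 0, ⁅u 1, z 0⁆⁆ + ⁅⁅u 1, ⁅u 1, u 0⁆⁆, z 1⁆) := by
          linear_combination (norm := module) (1 / 2 : ℂ) • h₂
        rw [h₅]
        exact P.smul_mem _ (P.add_mem (hu_lie 0 (by omega)) h₃)
    · rw [← lie_skew (u (i + 1 + 1)), h.comm 0 _ (by omega) (by omega), neg_zero, zero_lie]
      exact P.zero_mem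
  have hw0 : ⁅u 0, w⁆ = 0 := by
    rcases Nat.eq_zero_or_pos l with rfl | hl
    · rw [hwdef, hzdef, descend_top, ascend, ← lie_skew (u (0 + 1)), lie_neg, lie_neg,
        h.cube 0 rfl, neg_zero]
    · rw [hwdef, hzdef, descend_of_lt _ hl, ← hzdef]
      have h₁ : ⁅u 0, ⁅u 1, z 1⁆⁆ = ⁅⁅u 0, u 1⁆, z 1⁆ := by
        rw [lie_lie, hzz 1 le_rfl hl, lie_zero, sub_zero]
      rw [zero_add, h₁, leibniz_lie, hzz 1 le_rfl hl, lie_zero, add_zero, hup hl, smul_lie,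
        hzz 1 le_rfl hl, smul_zero]
  refine eq_top_of_lie_mem hgen ?_ ?_
  · rintro _ ⟨_ | i, rfl⟩
    · exact hPQ hu
    · exact hPQ (hT (tailGen u i).2)
  · rintro _ ⟨_ | i, rfl⟩
    · intro x hx
      rw [hQ] at hx
      refine lie_mem_sup_span (fun g hg => hPQ (hst' g hg _ hu)) ?_ x hx
      rintro _ ⟨_ | ⟨k, hk⟩ | ⟨k, hk⟩, rfl⟩
      · change ⁅u 0, w⁆ ∈ Q
        rw [hw0]
        exact Q.zero_mem
      · change ⁅u 0, ascend u k⁆ ∈ Q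
        cases k with
        | zero => simp [ascend]
        | succ k =>
          rw [h.lie_zero_ascend (hup (by omega)) (by omega)]
          exact Q.smul_mem _ (hPQ hu)
      · change ⁅u 0, z k⁆ ∈ Q
        cases k with
        | zero => exact hw
        | succ k =>
          rw [hzz _ (by omega) (by omega)]
          exact Q.zero_mem
    · intro x hx
      rw [hQ] at hx
      refine lie_mem_sup_span
        (fun g hg => hPQ (hT ((tail u).lie_mem (tailGen u i).2 hg))) ?_ x hx
      rintro _ ⟨_ | k, rfl⟩
      · exact hPQ (hwu i)
      · exact hPQ (hst _ ⟨i, rfl⟩ _ (hS k))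

end Generation

/-! ### Matrix units by integer codes, and the relations for the images -/

section MatrixUnits

variable {m : Type*} [Fintype m] [DecidableEq m] {code : m → ℤ}

/-- The matrix unit whose row and column have the codes `a` and `b`; it is `0` if there is no such
row or no such column. -/
def unitAt (code : m → ℤ) (a b : ℤ) : Matrix m m ℂ :=
  Matrix.of fun x y => if code x = a ∧ code y = b then 1 else 0

omit [DecidableEq m] in
theorem unitAt_mul_of_ne {a b c d : ℤ} (h : b ≠ c) : unitAt code a b * unitAt code c d = 0 := by
  ext x y
  rw [Matrix.mul_apply]
  refine Finset.sum_eq_zero fun k _ => ?_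
  simp only [unitAt, Matrix.of_apply]
  grind

omit [DecidableEq m] in
theorem unitAt_mul_same (hc : Function.Injective code) {a b d : ℤ} (h : ∃ x, code x = b) :
    unitAt code a b * unitAt code b d = unitAt code a d := by
  obtain ⟨k, rfl⟩ := h
  ext x y
  rw [Matrix.mul_apply, Finset.sum_eq_single k]
  · simp [unitAt, ← ite_and, and_comm]
  · intro k' _ hk
    simp [unitAt, hc.ne hk]
  · simp

/-- A root vector of a classical Lie algebra for the root `ε_a - ε_b`. -/
def rootAt (code : m → ℤ) (a b : ℤ) : Matrix m m ℂ :=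
  unitAt code a b - unitAt code (-b) (-a)

end MatrixUnits

/-- The codes of the basis vectors in type `B`. -/
def codeB (n : ℕ) : Unit ⊕ (Fin n ⊕ Fin n) → ℤ :=
  Sum.elim (fun _ => 0) (Sum.elim (fun i => i.val + 2) (fun i => -(i.val + 2)))

/-- The codes of the basis vectors in type `C`. -/
def codeC (n : ℕ) : Fin n ⊕ Fin n → ℤ :=
  Sum.elim (fun i => i.val + 2) (fun i => -(i.val + 2))

theorem codeB_injective (n : ℕ) : Function.Injective (codeB n) := by
  rintro (x | x | x) (y | y | y) h <;> simp only [codeB, Sum.elim_inl, Sum.elim_inr] at h <;>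
    simp only [Sum.inl.injEq, Sum.inr.injEq, reduceCtorEq] <;> first | rfl | omega

theorem codeC_injective (n : ℕ) : Function.Injective (codeC n) := by
  rintro (x | x) (y | y) h <;> simp only [codeC, Sum.elim_inl, Sum.elim_inr] at h <;>
    simp only [Sum.inl.injEq, Sum.inr.injEq, reduceCtorEq] <;> omega

theorem exists_codeB {n : ℕ} {a : ℤ}
    (h : a = 0 ∨ (2 ≤ a ∧ a ≤ n + 1) ∨ (-(n + 1) ≤ a ∧ a ≤ -2)) : ∃ x, codeB n x = a := by
  rcases h with rfl | h | h
  · exact ⟨Sum.inl (), rfl⟩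
  · exact ⟨Sum.inr (Sum.inl ⟨(a - 2).toNat, by omega⟩), by simp [codeB]; omega⟩
  · exact ⟨Sum.inr (Sum.inr ⟨(-a - 2).toNat, by omega⟩), by simp [codeB]; omega⟩

theorem exists_codeC {n : ℕ} {a : ℤ}
    (h : (2 ≤ a ∧ a ≤ n + 1) ∨ (-(n + 1) ≤ a ∧ a ≤ -2)) : ∃ x, codeC n x = a := by
  rcases h with h | h
  · exact ⟨Sum.inl ⟨(a - 2).toNat, by omega⟩, by simp [codeC]; omega⟩
  · exact ⟨Sum.inr ⟨(-a - 2).toNat, by omega⟩, by simp [codeC]; omega⟩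

/-- The product needs the inner code to be attained by a basis vector. Both conditions are one
linear arithmetic hypothesis, so that `omega` can discharge it inside `simp`. -/
theorem unitAtB_mul {n : ℕ} {a b c d : ℤ}
    (h : b = c ∧ (b = 0 ∨ (2 ≤ b ∧ b ≤ n + 1) ∨ (-(n + 1) ≤ b ∧ b ≤ -2))) :
    unitAt (codeB n) a b * unitAt (codeB n) c d = unitAt (codeB n) a d := by
  rw [← h.1]
  exact unitAt_mul_same (codeB_injective n) (exists_codeB h.2)

theorem unitAtC_mul {n : ℕ} {a b c d : ℤ}
    (h : b = c ∧ ((2 ≤ b ∧ b ≤ n + 1) ∨ (-(n + 1) ≤ b ∧ b ≤ -2))) :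
    unitAt (codeC n) a b * unitAt (codeC n) c d = unitAt (codeC n) a d := by
  rw [← h.1]
  exact unitAt_mul_same (codeC_injective n) (exists_codeC h.2)

/-- The images of the generators in type `B`. -/
noncomputable def soGen (n : ℕ) (β : ℕ → ℂ) (i : ℕ) :
    Matrix (Unit ⊕ (Fin n ⊕ Fin n)) (Unit ⊕ (Fin n ⊕ Fin n)) ℂ :=
  if i + 1 < n then
    rootAt (codeB n) (i + 2) (i + 3) + β (i - 1) • rootAt (codeB n) (i + 2) (i + 1)
  else if i + 1 = n then
    (2 : ℂ) • unitAt (codeB n) (i + 2) 0 - unitAt (codeB n) 0 (-(i + 2)) +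
      β (i - 1) • rootAt (codeB n) (i + 2) (i + 1)
  else 0

/-- The images of the generators in type `C`. -/
noncomputable def spGen (n : ℕ) (β : ℕ → ℂ) (i : ℕ) : Matrix (Fin n ⊕ Fin n) (Fin n ⊕ Fin n) ℂ :=
  if i + 1 < n then
    rootAt (codeC n) (i + 2) (i + 3) + β (i - 1) • rootAt (codeC n) (i + 2) (i + 1)
  else if i + 1 = n then
    unitAt (codeC n) (i + 2) (-(i + 2)) + (β (i - 1) / 2) • rootAt (codeC n) (i + 2) (i + 1) -
      (β (i - 1) / 2) ^ 2 • unitAt (codeC n) (-(i + 1)) (i + 1)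
  else 0

theorem soGen_comm (l : ℕ) (β : ℕ → ℂ) (i j : ℕ) (hij : i + 2 ≤ j) (hj : j ≤ l) :
    ⁅soGen (l + 1) β i, soGen (l + 1) β j⁆ = 0 := by
  rw [soGen, if_pos (by omega), soGen]
  split_ifs <;>
    simp (disch := omega) only [rootAt, Ring.lie_def, mul_add, add_mul, mul_sub, sub_mul,
      smul_mul_assoc, mul_smul_comm, unitAtB_mul, unitAt_mul_of_ne, smul_zero, sub_zero,
      zero_sub, add_zero, zero_add, mul_zero, zero_mul, neg_zero, neg_mul, mul_neg, sub_self]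

theorem soGen_up (l : ℕ) (β : ℕ → ℂ) (i : ℕ) (hi : i + 2 ≤ l) :
    ⁅soGen (l + 1) β i, ⁅soGen (l + 1) β i, soGen (l + 1) β (i + 1)⁆⁆ =
      (-(2 * β i)) • soGen (l + 1) β i := by
  simp only [soGen, if_pos (show i + 1 < l + 1 by omega),
      if_pos (show i + 1 + 1 < l + 1 by omega), Nat.cast_add, Nat.cast_one,
    add_assoc, Int.reduceAdd, Nat.add_sub_cancel, Nat.reduceAdd]
  simp (disch := omega) only [rootAt, Ring.lie_def, mul_add, add_mul, mul_sub, sub_mul,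
      smul_mul_assoc, mul_smul_comm, unitAtB_mul, unitAt_mul_of_ne, smul_zero, sub_zero,
      zero_sub, add_zero, zero_add, mul_zero, zero_mul, neg_zero, neg_mul, mul_neg, sub_self]
  module

theorem soGen_down (l : ℕ) (β : ℕ → ℂ) (i : ℕ) (hi : i + 2 ≤ l) :
    ⁅soGen (l + 1) β (i + 1), ⁅soGen (l + 1) β (i + 1), soGen (l + 1) β i⁆⁆ =
      (-(2 * β i)) • soGen (l + 1) β (i + 1) := by
  simp only [soGen, if_pos (show i + 1 < l + 1 by omega),
      if_pos (show i + 1 + 1 < l + 1 by omega), Nat.cast_add, Nat.cast_one,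
    add_assoc, Int.reduceAdd, Nat.add_sub_cancel, Nat.reduceAdd]
  simp (disch := omega) only [rootAt, Ring.lie_def, mul_add, add_mul, mul_sub, sub_mul,
      smul_mul_assoc, mul_smul_comm, unitAtB_mul, unitAt_mul_of_ne, smul_zero, sub_zero,
      zero_sub, add_zero, zero_add, mul_zero, zero_mul, neg_zero, neg_mul, mul_neg, sub_self]
  module

theorem soGen_up_last (l : ℕ) (β : ℕ → ℂ) (i : ℕ) (hi : i + 1 = l) :
    ⁅soGen (l + 1) β i, ⁅soGen (l + 1) β i, soGen (l + 1) β (i + 1)⁆⁆ =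
      (-(2 * β i)) • soGen (l + 1) β i := by
  simp only [soGen, if_pos (show i + 1 < l + 1 by omega),
      if_neg (show ¬ i + 1 + 1 < l + 1 by omega), if_pos (show i + 1 + 1 = l + 1 by omega),
      Nat.cast_add, Nat.cast_one,
    add_assoc, Int.reduceAdd, Nat.add_sub_cancel, Nat.reduceAdd]
  simp (disch := omega) only [rootAt, Ring.lie_def, mul_add, add_mul, mul_sub, sub_mul,
      smul_mul_assoc, mul_smul_comm, unitAtB_mul, unitAt_mul_of_ne, smul_zero, sub_zero,
      zero_sub, add_zero, zero_add, mul_zero, zero_mul, neg_zero, neg_mul, mul_neg, sub_self]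
  module

theorem soGen_cube (l : ℕ) (β : ℕ → ℂ) (i : ℕ) (hi : i + 1 = l) :
    ⁅soGen (l + 1) β (i + 1), ⁅soGen (l + 1) β (i + 1), ⁅soGen (l + 1) β (i + 1), soGen (l + 1) β i⁆⁆⁆ =
      0 := by
  simp only [soGen, if_pos (show i + 1 < l + 1 by omega),
      if_neg (show ¬ i + 1 + 1 < l + 1 by omega), if_pos (show i + 1 + 1 = l + 1 by omega),
      Nat.cast_add, Nat.cast_one,
    add_assoc, Int.reduceAdd, Nat.add_sub_cancel, Nat.reduceAdd]
  simp (disch := omega) only [rootAt, Ring.lie_def, mul_add, add_mul, mul_sub, sub_mul,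
      smul_mul_assoc, mul_smul_comm, unitAtB_mul, unitAt_mul_of_ne, smul_zero, sub_zero,
      zero_sub, add_zero, zero_add, mul_zero, zero_mul, neg_zero, neg_mul, mul_neg, sub_self]
  module

theorem spGen_comm (l : ℕ) (β : ℕ → ℂ) (i j : ℕ) (hij : i + 2 ≤ j) (hj : j ≤ l) :
    ⁅spGen (l + 1) β i, spGen (l + 1) β j⁆ = 0 := by
  rw [spGen, if_pos (by omega), spGen]
  split_ifs <;>
    simp (disch := omega) only [rootAt, Ring.lie_def, mul_add, add_mul, mul_sub, sub_mul,
      smul_mul_assoc, mul_smul_comm, unitAtC_mul, unitAt_mul_of_ne, smul_zero, sub_zero,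
      zero_sub, add_zero, zero_add, mul_zero, zero_mul, neg_zero, neg_mul, mul_neg, sub_self]

theorem spGen_up (l : ℕ) (β : ℕ → ℂ) (i : ℕ) (hi : i + 2 ≤ l) :
    ⁅spGen (l + 1) β i, ⁅spGen (l + 1) β i, spGen (l + 1) β (i + 1)⁆⁆ =
      (-(2 * β i)) • spGen (l + 1) β i := by
  simp only [spGen, if_pos (show i + 1 < l + 1 by omega),
      if_pos (show i + 1 + 1 < l + 1 by omega), Nat.cast_add, Nat.cast_one,
    add_assoc, Int.reduceAdd, Nat.add_sub_cancel, Nat.reduceAdd]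
  simp (disch := omega) only [rootAt, Ring.lie_def, mul_add, add_mul, mul_sub, sub_mul,
      smul_mul_assoc, mul_smul_comm, unitAtC_mul, unitAt_mul_of_ne, smul_zero, sub_zero,
      zero_sub, add_zero, zero_add, mul_zero, zero_mul, neg_zero, neg_mul, mul_neg, sub_self]
  module

theorem spGen_down (l : ℕ) (β : ℕ → ℂ) (i : ℕ) (hi : i + 2 ≤ l) :
    ⁅spGen (l + 1) β (i + 1), ⁅spGen (l + 1) β (i + 1), spGen (l + 1) β i⁆⁆ =
      (-(2 * β i)) • spGen (l + 1) β (i + 1) := by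
  simp only [spGen, if_pos (show i + 1 < l + 1 by omega),
      if_pos (show i + 1 + 1 < l + 1 by omega), Nat.cast_add, Nat.cast_one,
    add_assoc, Int.reduceAdd, Nat.add_sub_cancel, Nat.reduceAdd]
  simp (disch := omega) only [rootAt, Ring.lie_def, mul_add, add_mul, mul_sub, sub_mul,
      smul_mul_assoc, mul_smul_comm, unitAtC_mul, unitAt_mul_of_ne, smul_zero, sub_zero,
      zero_sub, add_zero, zero_add, mul_zero, zero_mul, neg_zero, neg_mul, mul_neg, sub_self]
  module

/-- The quadratic correction makes the last generator U a matrix of rank one: with `c = β i / 2` it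
is the column `e_(i+3) - c e_(-(i+2))` times the row `e*_(-(i+3)) + c e*_(i+2)`, and its square is
zero. Hence `⁅U, ⁅U, X⁆⁆ = -2 U X U` is automatically a multiple of U. -/
theorem spGen_down_last (l : ℕ) (β : ℕ → ℂ) (i : ℕ) (hi : i + 1 = l) :
    ⁅spGen (l + 1) β (i + 1), ⁅spGen (l + 1) β (i + 1), spGen (l + 1) β i⁆⁆ =
      (-(2 * β i)) • spGen (l + 1) β (i + 1) := by
  simp only [spGen, if_pos (show i + 1 < l + 1 by omega),
      if_neg (show ¬ i + 1 + 1 < l + 1 by omega), if_pos (show i + 1 + 1 = l + 1 by omega),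
      Nat.cast_add, Nat.cast_one,
    add_assoc, Int.reduceAdd, Nat.add_sub_cancel, Nat.reduceAdd]
  simp (disch := omega) only [rootAt, Ring.lie_def, mul_add, add_mul, mul_sub, sub_mul,
      smul_mul_assoc, mul_smul_comm, unitAtC_mul, unitAt_mul_of_ne, smul_zero, sub_zero,
      zero_sub, add_zero, zero_add, mul_zero, zero_mul, neg_zero, neg_mul, mul_neg, sub_self]
  module

theorem spGen_cube (l : ℕ) (β : ℕ → ℂ) (i : ℕ) (hi : i + 1 = l) :
    ⁅spGen (l + 1) β i, ⁅spGen (l + 1) β i, ⁅spGen (l + 1) β i, spGen (l + 1) β (i + 1)⁆⁆⁆ = 0 := by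
  simp only [spGen, if_pos (show i + 1 < l + 1 by omega),
      if_neg (show ¬ i + 1 + 1 < l + 1 by omega), if_pos (show i + 1 + 1 = l + 1 by omega),
      Nat.cast_add, Nat.cast_one,
    add_assoc, Int.reduceAdd, Nat.add_sub_cancel, Nat.reduceAdd]
  simp (disch := omega) only [rootAt, Ring.lie_def, mul_add, add_mul, mul_sub, sub_mul,
      smul_mul_assoc, mul_smul_comm, unitAtC_mul, unitAt_mul_of_ne, smul_zero, sub_zero,
      zero_sub, add_zero, zero_add, mul_zero, zero_mul, neg_zero, neg_mul, mul_neg, sub_self]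

theorem relB_soGen (l : ℕ) (β : ℕ → ℂ) : RelB l β (soGen (l + 1) β) where
  comm := soGen_comm l β
  up := soGen_up l β
  down := soGen_down l β
  up_last := soGen_up_last l β
  cube := soGen_cube l β

theorem relC_spGen (l : ℕ) (β : ℕ → ℂ) : RelC l β (spGen (l + 1) β) where
  comm := spGen_comm l β
  up := spGen_up l β
  down := spGen_down l β
  down_last := spGen_down_last l β
  cube := spGen_cube l β

/-! ### Independence of rows through their last nonzero entries -/

section LeadingEntries

variable {m : Type*} {ρ : m → ℤ} {r : m → ℂ} {d : m}

/-- The row vector `r` has its last nonzero entry at `d`, in the order given by `ρ`. -/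
structure LeadsAt (ρ : m → ℤ) (d : m) (r : m → ℂ) : Prop where
  zero : ∀ c, ρ d < ρ c → r c = 0
  ne_zero : r d ≠ 0

/-- As `A` has no entries above the first superdiagonal, the last position moves on by exactly one,
and only `r d * A d c` contributes to the new entry. -/
theorem LeadsAt.neg_vecMul [Fintype m] (hρ : Function.Injective ρ) (h : LeadsAt ρ d r)
    {A : Matrix m m ℂ} (hA : ∀ x y, ρ x + 1 < ρ y → A x y = 0) {c : m} (hc : ρ c = ρ d + 1)
    (hdc : A d c ≠ 0) : LeadsAt ρ c (-(Matrix.vecMul r A)) where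
  zero c' hc' := by
    rw [Pi.neg_apply, neg_eq_zero, Matrix.vecMul, dotProduct]
    refine Finset.sum_eq_zero fun k _ => ?_
    rcases lt_or_ge (ρ d) (ρ k) with hk | hk
    · rw [h.zero k hk, zero_mul]
    · rw [hA k c' (by omega), mul_zero]
  ne_zero := by
    rw [Pi.neg_apply, neg_ne_zero, Matrix.vecMul, dotProduct, Finset.sum_eq_single d]
    · exact mul_ne_zero h.ne_zero hdc
    · intro k _ hk
      rcases lt_or_gt_of_ne (hρ.ne hk) with hk | hk
      · rw [hA k c (by omega), mul_zero]
      · rw [h.zero k hk, zero_mul]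
    · simp

theorem linearIndependent_of_leadsAt {ι : Type*} (hρ : Function.Injective ρ) {d : ι → m}
    (hd : Function.Injective d) {r : ι → m → ℂ} (h : ∀ i, LeadsAt ρ (d i) (r i)) :
    LinearIndependent ℂ r := by
  classical
  rw [linearIndependent_iff']
  intro s g hg
  by_contra! hne
  obtain ⟨i₀, hi₀, hgi₀⟩ := hne
  obtain ⟨i, hi, hmax⟩ := (s.filter (g · ≠ 0)).exists_max_image (fun i => ρ (d i))
    ⟨i₀, by simp [hi₀, hgi₀]⟩
  rw [Finset.mem_filter] at hi
  have := congrFun hg (d i)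
  rw [Finset.sum_apply, Finset.sum_eq_single i, Pi.smul_apply, Pi.zero_apply, smul_eq_mul,
    mul_eq_zero] at this
  · exact this.elim hi.2 (h i).ne_zero
  · intro j hj hji
    by_cases hgj : g j = 0
    · rw [hgj, zero_smul, Pi.zero_apply]
    · have h₁ := hmax j (by simp [hj, hgj])
      have h₂ := hρ.ne (hd.ne hji)
      rw [Pi.smul_apply, (h j).zero _ (lt_of_le_of_ne h₁ h₂), smul_zero]
  · exact fun h => absurd hi.1 h

theorem row_lie_of_row_eq_zero [Fintype m] {A B : Matrix m m ℂ} {p : m} (hA : A p = 0) :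
    ⁅A, B⁆ p = -(Matrix.vecMul (B p) A) := by
  ext y
  simp [Ring.lie_def, Matrix.mul_apply, Matrix.vecMul, dotProduct, hA]

end LeadingEntries

/-! ### Faithfulness of a representation deduced from the tail -/

section Restriction

variable {L : Type*} [LieRing L] [LieAlgebra ℂ L] {m m' : Type*} [Fintype m] [DecidableEq m]
  [Fintype m'] [DecidableEq m'] {u : ℕ → L} {Φ : L →ₗ⁅ℂ⁆ Matrix m m ℂ}

theorem row_eq_zero_of_mem_tail {p : m} (h : ∀ i, Φ (u (i + 1)) p = 0) {x : L}
    (hx : x ∈ tail u) : Φ x p = 0 := by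
  induction hx using LieSubalgebra.lieSpan_induction with
  | mem x hx => obtain ⟨i, rfl⟩ := hx; exact h i
  | zero => rw [map_zero]; rfl
  | add x y _ _ hx hy => rw [map_add]; funext k; simp [hx, hy]
  | smul a x _ hx => rw [map_smul]; funext k; simp [hx]
  | lie x y _ _ hx hy => rw [LieHom.map_lie, row_lie_of_row_eq_zero hx, hy]; simp

theorem col_eq_zero_of_mem_tail {q : m} (h : ∀ i k, Φ (u (i + 1)) k q = 0) {x : L}
    (hx : x ∈ tail u) : ∀ k, Φ x k q = 0 := by
  induction hx using LieSubalgebra.lieSpan_induction with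
  | mem x hx => obtain ⟨i, rfl⟩ := hx; exact h i
  | zero => simp
  | add x y _ _ hx hy => simp [hx, hy]
  | smul a x _ hx => simp [hx]
  | lie x y _ _ hx hy => simp [Ring.lie_def, Matrix.mul_apply, hx, hy]

/-- The injectivity of a matrix representation `Φ` of `L` follows from that of the representation
of `tail u` that is obtained by deleting the row and the column of two basis vectors. -/
theorem injective_of_tail {e : m' → m} (he : Function.Injective e) {p q : m}
    (hpq : ∀ k, k ∉ Set.range e → k = p ∨ k = q)
    (hrow : ∀ i, Φ (u (i + 1)) p = 0) (hcol : ∀ i k, Φ (u (i + 1)) k q = 0)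
    {ι : Type*} {s : ι → L}
    (hs : (tail u).toSubmodule ⊔ Submodule.span ℂ (Set.range s) = ⊤)
    (hli : LinearIndependent ℂ (fun i => Φ (s i) p))
    (ih : ∀ Ψ : tail u →ₗ⁅ℂ⁆ Matrix m' m' ℂ, (∀ x, Ψ x = (Φ x).submatrix e e) →
      Function.Injective Ψ) : Function.Injective Φ := by
  let Ψ : tail u →ₗ⁅ℂ⁆ Matrix m' m' ℂ :=
    { toFun := fun x => (Φ x).submatrix e e
      map_add' := fun x y => by ext; simp
      map_smul' := fun a x => by ext; simp
      map_lie' := fun {x y} => by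
        -- Deletion is multiplicative here because the lost summands contain an entry of the zero
        -- row `p` of the right factor or of the zero column `q` of the left one.
        have key : ∀ x y : tail u, ((Φ x) * (Φ y)).submatrix e e =
            (Φ x).submatrix e e * (Φ y).submatrix e e := fun x y => by
          ext a b
          rw [Matrix.submatrix_apply, Matrix.mul_apply, Matrix.mul_apply]
          refine (Fintype.sum_of_injective e he _ _ ?_ (fun _ => rfl)).symm
          intro k hk
          rcases hpq k hk with rfl | rfl
          · rw [row_eq_zero_of_mem_tail hrow y.2, Pi.zero_apply, mul_zero]
          · rw [col_eq_zero_of_mem_tail hcol x.2, zero_mul]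
        rw [LieSubalgebra.coe_bracket, LieHom.map_lie, Ring.lie_def, Ring.lie_def, ← key, ← key]
        rfl }
  have hΨ := ih Ψ fun _ => rfl
  rw [injective_iff_map_eq_zero]
  intro x hx
  obtain ⟨t, ht, v, hv, rfl⟩ := Submodule.mem_sup.mp (hs ▸ Submodule.mem_top (x := x))
  let R : L →ₗ[ℂ] m → ℂ :=
    { toFun := fun x => Φ x p
      map_add' := fun x y => by rw [map_add]; rfl
      map_smul' := fun a x => by rw [map_smul]; rfl }
  -- The row `p` does not see `t`, so it isolates the chain part `v`.
  have hRv : R v = 0 := by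
    have h₁ : R (t + v) = 0 := by
      change Φ (t + v) p = 0
      rw [hx]
      rfl
    rwa [map_add, show R t = 0 from row_eq_zero_of_mem_tail hrow ht, zero_add] at h₁
  have hv0 : v = 0 := by
    obtain ⟨c, rfl⟩ := (Finsupp.mem_span_range_iff_exists_finsupp).mp hv
    have : c = 0 := by
      refine (linearIndependent_iff.mp hli) c ?_
      rw [Finsupp.linearCombination_apply, ← hRv, map_finsuppSum]
      simp only [map_smul]
      rfl
    simp [this]
  rw [hv0, add_zero] at hx ⊢
  have : Ψ ⟨t, ht⟩ = 0 := by
    change (Φ t).submatrix e e = 0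
    rw [hx]
    rfl
  simpa using congrArg Subtype.val (hΨ (this.trans (map_zero Ψ).symm))

theorem mem_span_singleton_of_generates {u : L}
    (h : LieSubalgebra.lieSpan ℂ L {u} = ⊤) (x : L) : x ∈ Submodule.span ℂ {u} := by
  have : Submodule.span ℂ {u} = ⊤ := by
    refine eq_top_of_lie_mem h Submodule.subset_span ?_
    rintro _ rfl x hx
    obtain ⟨c, rfl⟩ := Submodule.mem_span_singleton.mp hx
    simp
  rw [this]
  trivial

/-- A nonzero representation of a Lie algebra with a single generator is faithful. -/
theorem injective_of_generator {u : ℕ → L} (hvan : ∀ i, 1 ≤ i → u i = 0)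
    (h : LieSubalgebra.lieSpan ℂ L (Set.range u) = ⊤) (hΦ : Φ (u 0) ≠ 0) :
    Function.Injective Φ := by
  have h' : LieSubalgebra.lieSpan ℂ L {u 0} = ⊤ := by
    rw [← top_le_iff, ← h, LieSubalgebra.lieSpan_le]
    rintro _ ⟨i, rfl⟩
    cases i with
    | zero => exact LieSubalgebra.subset_lieSpan rfl
    | succ i => rw [hvan (i + 1) (by omega)]; exact LieSubalgebra.zero_mem _
  rw [injective_iff_map_eq_zero]
  intro x hx
  obtain ⟨c, rfl⟩ := Submodule.mem_span_singleton.mp (mem_span_singleton_of_generates h' x)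
  rw [map_smul, smul_eq_zero] at hx
  rw [hx.resolve_right hΦ, zero_smul]

end Restriction

/-! ### Entries of the generators, and deletion of the first pair of basis vectors -/

section Entries

theorem unitAt_apply_of_not {m : Type*} {code : m → ℤ} {a b : ℤ} {x y : m}
    (h : ¬(code x = a ∧ code y = b)) : unitAt code a b x y = 0 := if_neg h

theorem unitAt_apply_of {m : Type*} {code : m → ℤ} {a b : ℤ} {x y : m}
    (h : code x = a ∧ code y = b) : unitAt code a b x y = 1 := if_pos h

theorem unitAt_apply_congr {m m' : Type*} {code : m → ℤ} {code' : m' → ℤ} {a b a' b' : ℤ}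
    {x y : m} {x' y' : m'}
    (h : (code x = a ∧ code y = b) ↔ (code' x' = a' ∧ code' y' = b')) :
    unitAt code a b x y = unitAt code' a' b' x' y' := by
  simp only [unitAt, Matrix.of_apply, h]

/-- The position of a basis vector in the order `v_1, …, v_n, v_0, w_n, …, w_1`, by its code. -/
def orderB (n : ℕ) (x : Unit ⊕ (Fin n ⊕ Fin n)) : ℤ :=
  if 0 < codeB n x then codeB n x else if codeB n x = 0 then n + 2 else 2 * n + 4 + codeB n x

/-- The position of a basis vector in the order `v_1, …, v_n, w_n, …, w_1`, by its code. -/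
def orderC (n : ℕ) (x : Fin n ⊕ Fin n) : ℤ :=
  if 0 < codeC n x then codeC n x else 2 * n + 3 + codeC n x

theorem codeB_range {n : ℕ} (x : Unit ⊕ (Fin n ⊕ Fin n)) : codeB n x = 0 ∨
    (2 ≤ codeB n x ∧ codeB n x ≤ n + 1) ∨ (-(n + 1) ≤ codeB n x ∧ codeB n x ≤ -2) := by
  rcases x with x | x | x <;> simp [codeB] <;> omega

theorem codeC_range {n : ℕ} (x : Fin n ⊕ Fin n) :
    (2 ≤ codeC n x ∧ codeC n x ≤ n + 1) ∨ (-(n + 1) ≤ codeC n x ∧ codeC n x ≤ -2) := by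
  rcases x with x | x <;> simp [codeC] <;> omega

theorem orderB_injective (n : ℕ) : Function.Injective (orderB n) := by
  intro x y h
  have hx := codeB_range x
  have hy := codeB_range y
  refine codeB_injective n ?_
  unfold orderB at h
  split_ifs at h <;> omega

theorem orderC_injective (n : ℕ) : Function.Injective (orderC n) := by
  intro x y h
  have hx := codeC_range x
  have hy := codeC_range y
  refine codeC_injective n ?_
  unfold orderC at h
  split_ifs at h <;> omega

theorem soGen_apply_of_lt {n : ℕ} (β : ℕ → ℂ) (i : ℕ) (x y : Unit ⊕ (Fin n ⊕ Fin n))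
    (h : orderB n x + 1 < orderB n y) : soGen n β i x y = 0 := by
  unfold orderB at h
  unfold soGen
  split_ifs at h ⊢ <;>
    simp (disch := omega) only [rootAt, Matrix.add_apply, Matrix.sub_apply, Matrix.smul_apply,
      unitAt_apply_of_not, sub_zero, smul_zero, add_zero, Matrix.zero_apply]

theorem spGen_apply_of_lt {n : ℕ} (β : ℕ → ℂ) (i : ℕ) (x y : Fin n ⊕ Fin n)
    (h : orderC n x + 1 < orderC n y) : spGen n β i x y = 0 := by
  unfold orderC at h
  unfold spGen
  split_ifs at h ⊢ <;>
    simp (disch := omega) only [rootAt, Matrix.add_apply, Matrix.sub_apply, Matrix.smul_apply,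
      unitAt_apply_of_not, sub_zero, smul_zero, add_zero, Matrix.zero_apply]

theorem soGen_succ_row {n : ℕ} (β : ℕ → ℂ) (i : ℕ) (x y : Unit ⊕ (Fin n ⊕ Fin n))
    (hx : codeB n x = 2) : soGen n β (i + 1) x y = 0 := by
  unfold soGen
  push_cast
  split_ifs <;>
    simp (disch := omega) only [rootAt, Matrix.add_apply, Matrix.sub_apply, Matrix.smul_apply,
      unitAt_apply_of_not, sub_zero, smul_zero, add_zero, Matrix.zero_apply]

theorem soGen_succ_col {n : ℕ} (β : ℕ → ℂ) (i : ℕ) (x y : Unit ⊕ (Fin n ⊕ Fin n))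
    (hy : codeB n y = -2) : soGen n β (i + 1) x y = 0 := by
  unfold soGen
  push_cast
  split_ifs <;>
    simp (disch := omega) only [rootAt, Matrix.add_apply, Matrix.sub_apply, Matrix.smul_apply,
      unitAt_apply_of_not, sub_zero, smul_zero, add_zero, Matrix.zero_apply]

theorem spGen_succ_row {n : ℕ} (β : ℕ → ℂ) (i : ℕ) (x y : Fin n ⊕ Fin n)
    (hx : codeC n x = 2) : spGen n β (i + 1) x y = 0 := by
  unfold spGen
  push_cast
  split_ifs <;>
    simp (disch := omega) only [rootAt, Matrix.add_apply, Matrix.sub_apply, Matrix.smul_apply,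
      unitAt_apply_of_not, sub_zero, smul_zero, add_zero, Matrix.zero_apply]

theorem spGen_succ_col {n : ℕ} (β : ℕ → ℂ) (i : ℕ) (x y : Fin n ⊕ Fin n)
    (hy : codeC n y = -2) : spGen n β (i + 1) x y = 0 := by
  unfold spGen
  push_cast
  split_ifs <;>
    simp (disch := omega) only [rootAt, Matrix.add_apply, Matrix.sub_apply, Matrix.smul_apply,
      unitAt_apply_of_not, sub_zero, smul_zero, add_zero, Matrix.zero_apply]

/-- The inclusion of the index set of rank `n` into that of rank `n + 1` that avoids the first
pair of basis vectors, in type `B`. -/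
def succB (n : ℕ) : Unit ⊕ (Fin n ⊕ Fin n) → Unit ⊕ (Fin (n + 1) ⊕ Fin (n + 1)) :=
  Sum.map id (Sum.map Fin.succ Fin.succ)

/-- The inclusion of the index set of rank `n` into that of rank `n + 1` that avoids the first
pair of basis vectors, in type `C`. -/
def succC (n : ℕ) : Fin n ⊕ Fin n → Fin (n + 1) ⊕ Fin (n + 1) :=
  Sum.map Fin.succ Fin.succ

theorem succB_injective (n : ℕ) : Function.Injective (succB n) :=
  Function.injective_id.sumMap ((Fin.succ_injective n).sumMap (Fin.succ_injective n))

theorem succC_injective (n : ℕ) : Function.Injective (succC n) :=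
  (Fin.succ_injective n).sumMap (Fin.succ_injective n)

theorem eq_of_notMem_range_succB {n : ℕ} (k : Unit ⊕ (Fin (n + 1) ⊕ Fin (n + 1)))
    (hk : k ∉ Set.range (succB n)) : k = Bv 0 ∨ k = Bw 0 := by
  rcases k with _ | k | k
  · exact absurd ⟨Sum.inl (), rfl⟩ hk
  · cases k using Fin.cases with
    | zero => exact Or.inl rfl
    | succ k => exact absurd ⟨Bv k, rfl⟩ hk
  · cases k using Fin.cases with
    | zero => exact Or.inr rfl
    | succ k => exact absurd ⟨Bw k, rfl⟩ hk

theorem eq_of_notMem_range_succC {n : ℕ} (k : Fin (n + 1) ⊕ Fin (n + 1))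
    (hk : k ∉ Set.range (succC n)) : k = Sum.inl 0 ∨ k = Sum.inr 0 := by
  rcases k with k | k
  · cases k using Fin.cases with
    | zero => exact Or.inl rfl
    | succ k => exact absurd ⟨Sum.inl k, rfl⟩ hk
  · cases k using Fin.cases with
    | zero => exact Or.inr rfl
    | succ k => exact absurd ⟨Sum.inr k, rfl⟩ hk

theorem codeB_succB {n : ℕ} (x : Unit ⊕ (Fin n ⊕ Fin n)) :
    (0 < codeB n x ∧ codeB (n + 1) (succB n x) = codeB n x + 1) ∨
    (codeB n x = 0 ∧ codeB (n + 1) (succB n x) = 0) ∨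
    (codeB n x < 0 ∧ codeB (n + 1) (succB n x) = codeB n x - 1) := by
  rcases x with x | x | x <;> simp [codeB, succB] <;> omega

theorem codeC_succC {n : ℕ} (x : Fin n ⊕ Fin n) :
    (0 < codeC n x ∧ codeC (n + 1) (succC n x) = codeC n x + 1) ∨
    (codeC n x < 0 ∧ codeC (n + 1) (succC n x) = codeC n x - 1) := by
  rcases x with x | x <;> simp [codeC, succC] <;> omega

theorem rootAt_codeB_succ {n : ℕ} {a b : ℤ} (ha : 2 ≤ a) (hb : 1 ≤ b) :
    (rootAt (codeB (n + 1)) (a + 1) (b + 1)).submatrix (succB n) (succB n) =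
      rootAt (codeB n) a b := by
  ext x y
  have hx := codeB_succB x
  have hy := codeB_succB y
  have hx' := codeB_range x
  have hy' := codeB_range y
  simp only [rootAt, Matrix.submatrix_apply, Matrix.sub_apply]
  congr 1 <;> refine unitAt_apply_congr ?_ <;> omega

theorem rootAt_codeC_succ {n : ℕ} {a b : ℤ} (ha : 2 ≤ a) (hb : 1 ≤ b) :
    (rootAt (codeC (n + 1)) (a + 1) (b + 1)).submatrix (succC n) (succC n) =
      rootAt (codeC n) a b := by
  ext x y
  have hx := codeC_succC x
  have hy := codeC_succC y
  have hx' := codeC_range x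
  have hy' := codeC_range y
  simp only [rootAt, Matrix.submatrix_apply, Matrix.sub_apply]
  congr 1 <;> refine unitAt_apply_congr ?_ <;> omega

/-- Nonzero codes start at 2 in absolute value, so `±1` is never attained. Thus the deformation term
of `soGen` vanishes by itself at `i = 0`, and the first generator is no exception to the formula. -/
theorem rootAt_codeB_one {n : ℕ} (a : ℤ) : rootAt (codeB n) a 1 = 0 := by
  ext x y
  have hx := codeB_range x
  have hy := codeB_range y
  simp (disch := omega) only [rootAt, Matrix.sub_apply, unitAt_apply_of_not, sub_zero,
    Matrix.zero_apply]

theorem rootAt_codeC_one {n : ℕ} (a : ℤ) : rootAt (codeC n) a 1 = 0 := by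
  ext x y
  have hx := codeC_range x
  have hy := codeC_range y
  simp (disch := omega) only [rootAt, Matrix.sub_apply, unitAt_apply_of_not, sub_zero,
    Matrix.zero_apply]

/-- `i - 1 + 1` differs from `i` only at `i = 0`, where the root vector is zero. -/
theorem smul_rootAt_codeB_shift {n : ℕ} (β : ℕ → ℂ) (i : ℕ) :
    β i • rootAt (codeB n) (i + 2) (i + 1) = β (i - 1 + 1) • rootAt (codeB n) (i + 2) (i + 1) := by
  cases i with
  | zero => simp [rootAt_codeB_one]
  | succ i => rfl

theorem smul_rootAt_codeC_shift {n : ℕ} (c : ℕ → ℂ) (i : ℕ) :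
    c i • rootAt (codeC n) (i + 2) (i + 1) = c (i - 1 + 1) • rootAt (codeC n) (i + 2) (i + 1) := by
  cases i with
  | zero => simp [rootAt_codeC_one]
  | succ i => rfl

/-- For `i = 0` the deformation term lies in the column `v_1` and the row `w_1`. Deletion removes
it, so the tail again starts with an undeformed generator. -/
theorem soGen_succ_submatrix (n : ℕ) (β : ℕ → ℂ) (i : ℕ) :
    (soGen (n + 1) β (i + 1)).submatrix (succB n) (succB n) =
      soGen n (fun i => β (i + 1)) i := by
  have h₁ := rootAt_codeB_succ (n := n) (a := i + 2) (b := i + 3) (by omega) (by omega)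
  have h₂ := rootAt_codeB_succ (n := n) (a := i + 2) (b := i + 1) (by omega) (by omega)
  simp only [soGen, add_lt_add_iff_right, add_left_inj]
  split_ifs
  · rw [← smul_rootAt_codeB_shift, ← h₁, ← h₂]
    push_cast
    simp only [Nat.add_sub_cancel, add_assoc, Int.reduceAdd]
    rfl
  · rw [← smul_rootAt_codeB_shift, ← h₂]
    push_cast
    simp only [Nat.add_sub_cancel, add_assoc, Int.reduceAdd]
    ext x y
    have hx := codeB_succB x
    have hy := codeB_succB y
    have hx' := codeB_range x
    have hy' := codeB_range y
    simp only [Matrix.submatrix_apply, Matrix.sub_apply, Matrix.add_apply, Matrix.smul_apply]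
    rw [unitAt_apply_congr (a := i + 3) (b := 0) (code' := codeB n) (a' := i + 2)
        (b' := 0) (x' := x) (y' := y)
        (by omega),
      unitAt_apply_congr (a := 0) (b := -(i + 3)) (code' := codeB n) (a' := 0)
        (b' := -(i + 2)) (x' := x) (y' := y)
        (by omega)]
  · rfl

theorem spGen_succ_submatrix (n : ℕ) (β : ℕ → ℂ) (i : ℕ) :
    (spGen (n + 1) β (i + 1)).submatrix (succC n) (succC n) =
      spGen n (fun i => β (i + 1)) i := by
  have h₁ := rootAt_codeC_succ (n := n) (a := i + 2) (b := i + 3) (by omega) (by omega)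
  have h₂ := rootAt_codeC_succ (n := n) (a := i + 2) (b := i + 1) (by omega) (by omega)
  simp only [spGen, add_lt_add_iff_right, add_left_inj]
  split_ifs
  · rw [← smul_rootAt_codeC_shift, ← h₁, ← h₂]
    push_cast
    simp only [Nat.add_sub_cancel, add_assoc, Int.reduceAdd]
    rfl
  · rw [← smul_rootAt_codeC_shift (fun i => β i / 2), ← h₂]
    push_cast
    simp only [Nat.add_sub_cancel, add_assoc, Int.reduceAdd]
    ext x y
    have hx := codeC_succC x
    have hy := codeC_succC y
    have hx' := codeC_range x
    have hy' := codeC_range y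
    simp only [Matrix.submatrix_apply, Matrix.sub_apply, Matrix.add_apply, Matrix.smul_apply]
    rw [unitAt_apply_congr (a := i + 3) (b := -(i + 3)) (code' := codeC n) (a' := i + 2)
        (b' := -(i + 2)) (x' := x) (y' := y)
        (by omega),
      unitAt_apply_congr (a := -(i + 2)) (b := i + 2) (code' := codeC n) (a' := -(i + 1))
        (b' := i + 1) (x' := x) (y' := y)
        (by omega)]
    congr 1
    rcases i with _ | i
    · simp (disch := omega) only [unitAt_apply_of_not, smul_zero]
    · rfl
  · rfl

end Entries

/-! ### Leading entries of the chain, and the induction on the rank -/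

section Faithful

theorem orderB_of_code {n : ℕ} {x : Unit ⊕ (Fin n ⊕ Fin n)} {a : ℤ} (h : codeB n x = a) :
    orderB n x = if 0 < a then a else if a = 0 then (n : ℤ) + 2 else 2 * n + 4 + a := by
  rw [orderB, h]

theorem orderC_of_code {n : ℕ} {x : Fin n ⊕ Fin n} {a : ℤ} (h : codeC n x = a) :
    orderC n x = if 0 < a then a else 2 * (n : ℤ) + 3 + a := by
  rw [orderC, h]

theorem codeB_v {n : ℕ} (i : Fin n) : codeB n (Bv i) = i + 2 := rfl
theorem codeB_w {n : ℕ} (i : Fin n) : codeB n (Bw i) = -(i + 2) := rfl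
theorem codeB_zero (n : ℕ) : codeB n (B0 n) = 0 := rfl
theorem codeC_v {n : ℕ} (i : Fin n) : codeC n (Sum.inl i) = i + 2 := rfl
theorem codeC_w {n : ℕ} (i : Fin n) : codeC n (Sum.inr i) = -(i + 2) := rfl

variable {n : ℕ} (β : ℕ → ℂ) {i : ℕ}

theorem soGen_v_v (hi : i + 1 < n) :
    soGen n β i (Bv ⟨i, by omega⟩) (Bv ⟨i + 1, hi⟩) = 1 := by
  have h₁ := codeB_v (⟨i, by omega⟩ : Fin n)
  have h₂ := codeB_v (⟨i + 1, hi⟩ : Fin n)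
  push_cast at h₁ h₂
  rw [soGen, if_pos hi]
  simp (disch := omega) only [rootAt, Matrix.add_apply, Matrix.sub_apply, Matrix.smul_apply,
    unitAt_apply_of_not, unitAt_apply_of, sub_zero, smul_zero, add_zero]

theorem soGen_w_w (hi : i + 1 < n) :
    soGen n β i (Bw ⟨i + 1, hi⟩) (Bw ⟨i, by omega⟩) = -1 := by
  have h₁ := codeB_w (⟨i, by omega⟩ : Fin n)
  have h₂ := codeB_w (⟨i + 1, hi⟩ : Fin n)
  push_cast at h₁ h₂
  rw [soGen, if_pos hi]
  simp (disch := omega) only [rootAt, Matrix.add_apply, Matrix.sub_apply, Matrix.smul_apply,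
    unitAt_apply_of_not, unitAt_apply_of, sub_zero, zero_sub, smul_zero, add_zero]

theorem soGen_v_zero (hi : i + 1 = n) :
    soGen n β i (Bv ⟨i, by omega⟩) (B0 n) = 2 := by
  have h₁ := codeB_v (⟨i, by omega⟩ : Fin n)
  have h₂ := codeB_zero n
  push_cast at h₁
  rw [soGen, if_neg (by omega), if_pos hi]
  simp (disch := omega) only [rootAt, Matrix.add_apply, Matrix.sub_apply, Matrix.smul_apply,
    unitAt_apply_of_not, unitAt_apply_of, sub_zero, smul_zero, add_zero, smul_eq_mul, mul_one,
    mul_zero]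

theorem soGen_zero_w (hi : i + 1 = n) :
    soGen n β i (B0 n) (Bw ⟨i, by omega⟩) = -1 := by
  have h₁ := codeB_w (⟨i, by omega⟩ : Fin n)
  have h₂ := codeB_zero n
  push_cast at h₁
  rw [soGen, if_neg (by omega), if_pos hi]
  simp (disch := omega) only [rootAt, Matrix.add_apply, Matrix.sub_apply, Matrix.smul_apply,
    unitAt_apply_of_not, unitAt_apply_of, sub_zero, zero_sub, smul_zero, add_zero]

theorem spGen_v_v (hi : i + 1 < n) :
    spGen n β i (Sum.inl ⟨i, by omega⟩) (Sum.inl ⟨i + 1, hi⟩) = 1 := by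
  have h₁ := codeC_v (⟨i, by omega⟩ : Fin n)
  have h₂ := codeC_v (⟨i + 1, hi⟩ : Fin n)
  push_cast at h₁ h₂
  rw [spGen, if_pos hi]
  simp (disch := omega) only [rootAt, Matrix.add_apply, Matrix.sub_apply, Matrix.smul_apply,
    unitAt_apply_of_not, unitAt_apply_of, sub_zero, smul_zero, add_zero]

theorem spGen_w_w (hi : i + 1 < n) :
    spGen n β i (Sum.inr ⟨i + 1, hi⟩) (Sum.inr ⟨i, by omega⟩) = -1 := by
  have h₁ := codeC_w (⟨i, by omega⟩ : Fin n)
  have h₂ := codeC_w (⟨i + 1, hi⟩ : Fin n)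
  push_cast at h₁ h₂
  rw [spGen, if_pos hi]
  simp (disch := omega) only [rootAt, Matrix.add_apply, Matrix.sub_apply, Matrix.smul_apply,
    unitAt_apply_of_not, unitAt_apply_of, sub_zero, zero_sub, smul_zero, add_zero]

theorem spGen_v_w (hi : i + 1 = n) :
    spGen n β i (Sum.inl ⟨i, by omega⟩) (Sum.inr ⟨i, by omega⟩) = 1 := by
  have h₁ := codeC_v (⟨i, by omega⟩ : Fin n)
  have h₂ := codeC_w (⟨i, by omega⟩ : Fin n)
  push_cast at h₁ h₂
  rw [spGen, if_neg (by omega), if_pos hi]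
  simp (disch := omega) only [rootAt, Matrix.add_apply, Matrix.sub_apply, Matrix.smul_apply,
    unitAt_apply_of_not, unitAt_apply_of, sub_zero, smul_zero, add_zero]

theorem soGen_row_zero (l : ℕ) : LeadsAt (orderB (l + 2)) (Bv 1) (soGen (l + 2) β 0 (Bv 0)) where
  zero c hc := by
    refine soGen_apply_of_lt β 0 _ _ ?_
    have h₁ := orderB_of_code (codeB_v (0 : Fin (l + 2)))
    have h₂ := orderB_of_code (codeB_v (1 : Fin (l + 2)))
    rw [if_pos (by simp)] at h₁
    rw [if_pos (by simp)] at h₂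
    simp at h₁ h₂
    omega
  ne_zero := by
    have := soGen_v_v (n := l + 2) β (i := 0) (by omega)
    exact this.trans_ne one_ne_zero

theorem spGen_row_zero (l : ℕ) :
    LeadsAt (orderC (l + 2)) (Sum.inl 1) (spGen (l + 2) β 0 (Sum.inl 0)) where
  zero c hc := by
    refine spGen_apply_of_lt β 0 _ _ ?_
    have h₁ := orderC_of_code (codeC_v (0 : Fin (l + 2)))
    have h₂ := orderC_of_code (codeC_v (1 : Fin (l + 2)))
    rw [if_pos (by simp)] at h₁
    rw [if_pos (by simp)] at h₂
    simp at h₁ h₂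
    omega
  ne_zero := by
    have := spGen_v_v (n := l + 2) β (i := 0) (by omega)
    exact this.trans_ne one_ne_zero

variable {L : Type*} [LieRing L] [LieAlgebra ℂ L] {u : ℕ → L} {l : ℕ} {β}

section TypeB

variable {Φ : L →ₗ⁅ℂ⁆ Matrix (Unit ⊕ (Fin (l + 2) ⊕ Fin (l + 2)))
  (Unit ⊕ (Fin (l + 2) ⊕ Fin (l + 2))) ℂ}

theorem LeadsAt.stepB (hΦ : ∀ i, Φ (u i) = soGen (l + 2) β i) {x : L} {i : ℕ}
    {c d : Unit ⊕ (Fin (l + 2) ⊕ Fin (l + 2))}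
    (h : LeadsAt (orderB (l + 2)) d (Φ x (Bv 0))) (hc : orderB (l + 2) c = orderB (l + 2) d + 1)
    (hdc : soGen (l + 2) β (i + 1) d c ≠ 0) :
    LeadsAt (orderB (l + 2)) c (Φ ⁅u (i + 1), x⁆ (Bv 0)) := by
  rw [LieHom.map_lie, hΦ, row_lie_of_row_eq_zero]
  · exact h.neg_vecMul (orderB_injective _) (soGen_apply_of_lt β _) hc hdc
  · ext y
    exact soGen_succ_row β i _ _ (by simp [codeB_v])

theorem leadsAt_ascendB (hΦ : ∀ i, Φ (u i) = soGen (l + 2) β i) {k : ℕ} (hk : k ≤ l) :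
    LeadsAt (orderB (l + 2)) (Bv ⟨k + 1, by omega⟩) (Φ (ascend u k) (Bv 0)) := by
  induction k with
  | zero =>
    rw [ascend, hΦ]
    exact soGen_row_zero β l
  | succ k ih =>
    refine (ih (by omega)).stepB hΦ ?_ ?_
    · rw [orderB_of_code (codeB_v _), orderB_of_code (codeB_v _)]
      push_cast
      split_ifs <;> omega
    · rw [soGen_v_v β (by omega)]
      exact one_ne_zero

theorem leadsAt_ascendB_last (hΦ : ∀ i, Φ (u i) = soGen (l + 2) β i) :
    LeadsAt (orderB (l + 2)) (B0 (l + 2)) (Φ (ascend u (l + 1)) (Bv 0)) := by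
  refine (leadsAt_ascendB hΦ le_rfl).stepB hΦ ?_ ?_
  · rw [orderB_of_code (codeB_v _), orderB_of_code (codeB_zero _)]
    push_cast
    split_ifs <;> omega
  · rw [soGen_v_zero β rfl]
    exact two_ne_zero

theorem leadsAt_descendB (hΦ : ∀ i, Φ (u i) = soGen (l + 2) β i) {k : ℕ} (hk : k ≤ l) :
    LeadsAt (orderB (l + 2)) (Bw ⟨k + 1, by omega⟩)
      (Φ (descend l u (ascend u (l + 1)) k) (Bv 0)) := by
  induction hk using Nat.decreasingInduction with
  | self =>
    rw [descend_top]
    refine (leadsAt_ascendB_last hΦ).stepB hΦ ?_ ?_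
    · rw [orderB_of_code (codeB_w _), orderB_of_code (codeB_zero _)]
      push_cast
      split_ifs <;> omega
    · rw [soGen_zero_w β rfl]
      exact neg_ne_zero.mpr one_ne_zero
  | of_succ k hk ih =>
    rw [descend_of_lt _ hk]
    refine ih.stepB hΦ ?_ ?_
    · rw [orderB_of_code (codeB_w _), orderB_of_code (codeB_w _)]
      push_cast
      split_ifs <;> omega
    · rw [soGen_w_w β (by omega)]
      exact neg_ne_zero.mpr one_ne_zero

theorem linearIndependent_chainB (hΦ : ∀ i, Φ (u i) = soGen (l + 2) β i) :
    LinearIndependent ℂ fun i => Φ (chainB l u i) (Bv 0) := by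
  let d : Fin (l + 2) ⊕ Fin (l + 1) → Unit ⊕ (Fin (l + 2) ⊕ Fin (l + 2)) :=
    Sum.elim (fun k => if hk : k.val ≤ l then Bv ⟨k + 1, by omega⟩ else B0 (l + 2))
      (fun k => Bw ⟨k + 1, by omega⟩)
  refine linearIndependent_of_leadsAt (orderB_injective (l + 2)) (d := d) ?_ ?_
  · rintro (⟨j, hj⟩ | ⟨j, hj⟩) (⟨k, hk⟩ | ⟨k, hk⟩) h <;>
      simp only [d, Sum.elim_inl, Sum.elim_inr] at h <;> (try split_ifs at h) <;>
      simp only [reduceCtorEq, Sum.inl.injEq, Sum.inr.injEq, Fin.mk.injEq] at h ⊢ <;> omega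
  · rintro (⟨k, hk⟩ | ⟨k, hk⟩)
    · simp only [d, Sum.elim_inl, chainB]
      split_ifs with hkl
      · exact leadsAt_ascendB hΦ hkl
      · obtain rfl : k = l + 1 := by omega
        exact leadsAt_ascendB_last hΦ
    · exact leadsAt_descendB hΦ (by omega)

end TypeB

section TypeC

variable {Φ : L →ₗ⁅ℂ⁆ Matrix (Fin (l + 2) ⊕ Fin (l + 2)) (Fin (l + 2) ⊕ Fin (l + 2)) ℂ}

theorem LeadsAt.stepC (hΦ : ∀ i, Φ (u i) = spGen (l + 2) β i) {x : L} {i : ℕ}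
    {c d : Fin (l + 2) ⊕ Fin (l + 2)}
    (h : LeadsAt (orderC (l + 2)) d (Φ x (Sum.inl 0)))
    (hc : orderC (l + 2) c = orderC (l + 2) d + 1)
    (hdc : spGen (l + 2) β (i + 1) d c ≠ 0) :
    LeadsAt (orderC (l + 2)) c (Φ ⁅u (i + 1), x⁆ (Sum.inl 0)) := by
  rw [LieHom.map_lie, hΦ, row_lie_of_row_eq_zero]
  · exact h.neg_vecMul (orderC_injective _) (spGen_apply_of_lt β _) hc hdc
  · ext y
    exact spGen_succ_row β i _ _ (by simp [codeC_v])

theorem leadsAt_ascendC (hΦ : ∀ i, Φ (u i) = spGen (l + 2) β i) {k : ℕ} (hk : k ≤ l) :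
    LeadsAt (orderC (l + 2)) (Sum.inl ⟨k + 1, by omega⟩) (Φ (ascend u k) (Sum.inl 0)) := by
  induction k with
  | zero =>
    rw [ascend, hΦ]
    exact spGen_row_zero β l
  | succ k ih =>
    refine (ih (by omega)).stepC hΦ ?_ ?_
    · rw [orderC_of_code (codeC_v _), orderC_of_code (codeC_v _)]
      push_cast
      split_ifs <;> omega
    · rw [spGen_v_v β (by omega)]
      exact one_ne_zero

theorem leadsAt_descendC (hΦ : ∀ i, Φ (u i) = spGen (l + 2) β i) {k : ℕ} (hk : k ≤ l) :
    LeadsAt (orderC (l + 2)) (Sum.inr ⟨k + 1, by omega⟩)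
      (Φ (descend l u (ascend u l) k) (Sum.inl 0)) := by
  induction hk using Nat.decreasingInduction with
  | self =>
    rw [descend_top]
    refine (leadsAt_ascendC hΦ le_rfl).stepC hΦ ?_ ?_
    · rw [orderC_of_code (codeC_w _), orderC_of_code (codeC_v _)]
      push_cast
      split_ifs <;> omega
    · rw [spGen_v_w β rfl]
      exact one_ne_zero
  | of_succ k hk ih =>
    rw [descend_of_lt _ hk]
    refine ih.stepC hΦ ?_ ?_
    · rw [orderC_of_code (codeC_w _), orderC_of_code (codeC_w _)]
      push_cast
      split_ifs <;> omega
    · rw [spGen_w_w β (by omega)]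
      exact neg_ne_zero.mpr one_ne_zero

/-- The row `v_1` of `u 0` is not zero, so `LeadsAt.stepC` does not apply. The entry at `w_1` is
`Z(v_2, w_1) + Z(v_1, w_2)`, and the symmetry of the upper right block of a symplectic matrix turns
it into twice the leading entry of `z 0`. -/
theorem leadsAt_highest (hΦ : ∀ i, Φ (u i) = spGen (l + 2) β i)
    (hsymm : ∀ x i j, Φ x (Sum.inl i) (Sum.inr j) = Φ x (Sum.inl j) (Sum.inr i)) :
    LeadsAt (orderC (l + 2)) (Sum.inr 0)
      (Φ ⁅u 0, descend l u (ascend u l) 0⁆ (Sum.inl 0)) where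
  zero c hc := by
    have h₀ := orderC_of_code (codeC_w (0 : Fin (l + 2)))
    rw [if_neg (by simp)] at h₀
    have h₁ := codeC_range c
    unfold orderC at hc h₀
    simp only [codeC_w, Fin.val_zero] at hc
    push_cast at *
    split_ifs at hc <;> omega
  ne_zero := by
    set Z := Φ (descend l u (ascend u l) 0) with hZ
    have hz : Z (Sum.inl 0) (Sum.inr 1) ≠ 0 := (leadsAt_descendC hΦ (Nat.zero_le l)).ne_zero
    have hu : Φ (u 0) = rootAt (codeC (l + 2)) 2 3 := by
      rw [hΦ, spGen, if_pos (by omega)]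
      simp [rootAt_codeC_one]
    have h₁ : (Φ (u 0) * Z) (Sum.inl 0) (Sum.inr 0) = Z (Sum.inl 1) (Sum.inr 0) := by
      rw [Matrix.mul_apply, Finset.sum_eq_single (Sum.inl 1)]
      · rw [hu, rootAt, Matrix.sub_apply, unitAt_apply_of (by simp [codeC]),
          unitAt_apply_of_not (by simp [codeC]), sub_zero, one_mul]
      · intro k _ hk
        have : codeC (l + 2) k ≠ 3 := fun h => hk (codeC_injective _ (h.trans (by simp [codeC])))
        rw [hu, rootAt, Matrix.sub_apply, unitAt_apply_of_not (by simp [this]),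
          unitAt_apply_of_not (by simp [codeC]), sub_zero, zero_mul]
      · simp
    have h₂ : (Z * Φ (u 0)) (Sum.inl 0) (Sum.inr 0) = -Z (Sum.inl 0) (Sum.inr 1) := by
      rw [Matrix.mul_apply, Finset.sum_eq_single (Sum.inr 1)]
      · rw [hu, rootAt, Matrix.sub_apply, unitAt_apply_of_not (by simp [codeC]),
          unitAt_apply_of (by simp [codeC]), zero_sub, mul_neg, mul_one]
      · intro k _ hk
        have : codeC (l + 2) k ≠ -3 := fun h => hk (codeC_injective _ (h.trans (by simp [codeC])))
        rw [hu, rootAt, Matrix.sub_apply, unitAt_apply_of_not (by simp [codeC]),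
          unitAt_apply_of_not (by simp [this]), sub_zero, mul_zero]
      · simp
    have h₃ : Z (Sum.inl 1) (Sum.inr 0) = Z (Sum.inl 0) (Sum.inr 1) := hsymm _ _ _
    rw [LieHom.map_lie, Ring.lie_def, ← hZ, Matrix.sub_apply, h₁, h₂, h₃, sub_neg_eq_add,
      ← two_mul]
    exact mul_ne_zero two_ne_zero hz

theorem linearIndependent_chainC (hΦ : ∀ i, Φ (u i) = spGen (l + 2) β i)
    (hsymm : ∀ x i j, Φ x (Sum.inl i) (Sum.inr j) = Φ x (Sum.inl j) (Sum.inr i)) :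
    LinearIndependent ℂ fun i => Φ (chainC l u i) (Sum.inl 0) := by
  let d : Unit ⊕ (Fin (l + 1) ⊕ Fin (l + 1)) → Fin (l + 2) ⊕ Fin (l + 2) :=
    Sum.elim (fun _ => Sum.inr ⟨0, by omega⟩) (Sum.elim (fun k => Sum.inl ⟨k + 1, by omega⟩)
      (fun k => Sum.inr ⟨k + 1, by omega⟩))
  refine linearIndependent_of_leadsAt (orderC_injective (l + 2)) (d := d) ?_ ?_
  · rintro (⟨⟩ | ⟨j, hj⟩ | ⟨j, hj⟩) (⟨⟩ | ⟨k, hk⟩ | ⟨k, hk⟩) h <;>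
      simp only [d, Sum.elim_inl, Sum.elim_inr, reduceCtorEq, Sum.inl.injEq, Sum.inr.injEq,
        Fin.mk.injEq] at h ⊢ <;> omega
  · rintro (⟨⟩ | ⟨k, hk⟩ | ⟨k, hk⟩)
    · exact leadsAt_highest hΦ hsymm
    · exact leadsAt_ascendC hΦ (by omega)
    · exact leadsAt_descendC hΦ (by omega)

end TypeC

/-- The algebra ranges over everything generated by elements with these relations, because the tail
is not known in advance to be the presented algebra of smaller rank. -/
theorem RelB.injective (l : ℕ) : ∀ {L : Type} [LieRing L] [LieAlgebra ℂ L] {β : ℕ → ℂ}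
    {u : ℕ → L} (_ : RelB l β u) (_ : ∀ i, l + 1 ≤ i → u i = 0)
    (_ : LieSubalgebra.lieSpan ℂ L (Set.range u) = ⊤)
    {Φ : L →ₗ⁅ℂ⁆ Matrix (Unit ⊕ (Fin (l + 1) ⊕ Fin (l + 1)))
      (Unit ⊕ (Fin (l + 1) ⊕ Fin (l + 1))) ℂ}
    (_ : ∀ i, Φ (u i) = soGen (l + 1) β i), Function.Injective Φ := by
  induction l with
  | zero =>
    intro L _ _ β u _ hvan hgen Φ hΦ
    refine injective_of_generator hvan hgen fun h0 => ?_
    have := soGen_v_zero (n := 1) β (i := 0) rfl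
    rw [← hΦ, h0] at this
    exact two_ne_zero this.symm
  | succ l ih =>
    intro L _ _ β u h hvan hgen Φ hΦ
    refine injective_of_tail (succB_injective _) eq_of_notMem_range_succB ?_ ?_
      (h.sup_span_chainB hvan hgen) (linearIndependent_chainB hΦ) ?_
    · intro i
      ext y
      rw [hΦ]
      exact soGen_succ_row β i _ _ (by simp [codeB_v])
    · intro i k
      rw [hΦ]
      exact soGen_succ_col β i _ _ (by simp [codeB_w])
    · intro Ψ hΨ
      refine ih h.tail_rel (fun i hi => Subtype.ext (hvan _ (by omega)))
        (lieSpan_range_tailGen u) fun i => ?_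
      rw [hΨ, coe_tailGen, hΦ, soGen_succ_submatrix]

/-- The symmetry hypothesis keeps what `leadsAt_highest` needs of the symplectic condition, and it
passes to submatrices. -/
theorem RelC.injective (l : ℕ) : ∀ {L : Type} [LieRing L] [LieAlgebra ℂ L] {β : ℕ → ℂ}
    {u : ℕ → L} (_ : RelC l β u) (_ : ∀ i, l + 1 ≤ i → u i = 0)
    (_ : LieSubalgebra.lieSpan ℂ L (Set.range u) = ⊤)
    {Φ : L →ₗ⁅ℂ⁆ Matrix (Fin (l + 1) ⊕ Fin (l + 1)) (Fin (l + 1) ⊕ Fin (l + 1)) ℂ}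
    (_ : ∀ i, Φ (u i) = spGen (l + 1) β i)
    (_ : ∀ x i j, Φ x (Sum.inl i) (Sum.inr j) = Φ x (Sum.inl j) (Sum.inr i)),
    Function.Injective Φ := by
  induction l with
  | zero =>
    intro L _ _ β u _ hvan hgen Φ hΦ _
    refine injective_of_generator hvan hgen fun h0 => ?_
    have := spGen_v_w (n := 1) β (i := 0) rfl
    rw [← hΦ, h0] at this
    exact one_ne_zero this.symm
  | succ l ih =>
    intro L _ _ β u h hvan hgen Φ hΦ hsymm
    refine injective_of_tail (succC_injective _) eq_of_notMem_range_succC ?_ ?_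
      (h.sup_span_chainC hvan hgen) (linearIndependent_chainC hΦ hsymm) ?_
    · intro i
      ext y
      rw [hΦ]
      exact spGen_succ_row β i _ _ (by simp [codeC_v])
    · intro i k
      rw [hΦ]
      exact spGen_succ_col β i _ _ (by simp [codeC_w])
    · intro Ψ hΨ
      refine ih h.tail_rel (fun i hi => Subtype.ext (hvan _ (by omega)))
        (lieSpan_range_tailGen u) (fun i => ?_) fun x i j => ?_
      · rw [hΨ, coe_tailGen, hΦ, spGen_succ_submatrix]
      · rw [hΨ]
        exact hsymm _ _ _

end Faithful

/-! ### Generators and relations of the electrical Lie algebra -/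

section Presentation

variable {I : Type} (A : Matrix I I ℤ) (b : I → I → ℂ)

/-- The projection of the free Lie algebra to `EdgeAlgebra A b`. -/
noncomputable def edgeMk : FreeLieAlgebra ℂ I →ₗ⁅ℂ⁆ EdgeAlgebra A b :=
  { (edgeIdeal A b).toSubmodule.mkQ with
    map_lie' := fun {x y} => LieSubmodule.Quotient.mk_bracket (edgeIdeal A b) x y }

theorem edgeMk_surjective : Function.Surjective (edgeMk A b) :=
  Submodule.mkQ_surjective _

theorem edgeMk_edgeRelator {i j : I} (h : i ≠ j) : edgeMk A b (edgeRelator A b i j) = 0 :=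
  (Submodule.Quotient.mk_eq_zero _).mpr (LieSubmodule.subset_lieSpan ⟨i, j, h, rfl⟩)

/-- The universal map into the generated subalgebra, followed by the inclusion, fixes the generators
and is therefore the identity. -/
theorem lieSpan_range_of {X : Type} :
    LieSubalgebra.lieSpan ℂ (FreeLieAlgebra ℂ X) (Set.range (FreeLieAlgebra.of ℂ)) = ⊤ := by
  set S := LieSubalgebra.lieSpan ℂ (FreeLieAlgebra ℂ X) (Set.range (FreeLieAlgebra.of ℂ))
  let f : FreeLieAlgebra ℂ X →ₗ⁅ℂ⁆ S := FreeLieAlgebra.lift ℂ fun i =>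
    ⟨FreeLieAlgebra.of ℂ i, LieSubalgebra.subset_lieSpan ⟨i, rfl⟩⟩
  have hf : S.incl.comp f = LieHom.id := by
    refine FreeLieAlgebra.hom_ext fun i => ?_
    simp [f]
  refine eq_top_iff.mpr fun x _ => ?_
  have : (f x : FreeLieAlgebra ℂ X) = x := LieHom.congr_fun hf x
  rw [← this]
  exact (f x).2

theorem lieSpan_range_u :
    LieSubalgebra.lieSpan ℂ (EdgeAlgebra A b) (Set.range (EdgeAlgebra.u A b)) = ⊤ := by
  refine eq_top_iff.mpr fun x _ => ?_
  obtain ⟨y, rfl⟩ := edgeMk_surjective A b x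
  have hle : LieSubalgebra.lieSpan ℂ _ (Set.range (FreeLieAlgebra.of ℂ)) ≤
      (LieSubalgebra.lieSpan ℂ (EdgeAlgebra A b) (Set.range (EdgeAlgebra.u A b))).comap
        (edgeMk A b) := by
    rw [LieSubalgebra.lieSpan_le]
    rintro _ ⟨i, rfl⟩
    exact LieSubalgebra.subset_lieSpan ⟨i, rfl⟩
  rw [lieSpan_range_of] at hle
  exact hle (LieSubalgebra.mem_top y)

variable {M : Type*} [LieRing M] [LieAlgebra ℂ M]

/-- The left-hand side of the deformed Serre relation, evaluated at elements of a Lie algebra. -/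
noncomputable def serreExpr (x : I → M) (i j : I) : M :=
  ((LieAlgebra.ad ℂ M (x i)) ^ (1 - A i j).toNat) (x j) +
    if A i j = -1 then (2 * b i j) • x i else 0

variable {A b}

theorem map_ad_pow {M' : Type*} [LieRing M'] [LieAlgebra ℂ M'] (f : M →ₗ⁅ℂ⁆ M') (x y : M)
    (k : ℕ) : f (((LieAlgebra.ad ℂ M x) ^ k) y) = ((LieAlgebra.ad ℂ M' (f x)) ^ k) (f y) := by
  induction k with
  | zero => simp
  | succ k ih => simp [pow_succ', ih]

theorem map_edgeRelator (f : FreeLieAlgebra ℂ I →ₗ⁅ℂ⁆ M) (i j : I) :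
    f (edgeRelator A b i j) = serreExpr A b (fun i => f (FreeLieAlgebra.of ℂ i)) i j := by
  rw [edgeRelator, serreExpr, map_add, map_ad_pow]
  split_ifs <;> simp

theorem serreExpr_u {i j : I} (h : i ≠ j) : serreExpr A b (EdgeAlgebra.u A b) i j = 0 := by
  rw [← edgeMk_edgeRelator A b h, map_edgeRelator]
  rfl

/-- Elements of a Lie algebra that satisfy the deformed Serre relations define a homomorphism. -/
theorem exists_edgeLift (x : I → M) (h : ∀ i j, i ≠ j → serreExpr A b x i j = 0) :
    ∃ φ : EdgeAlgebra A b →ₗ⁅ℂ⁆ M, ∀ i, φ (EdgeAlgebra.u A b i) = x i := by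
  let f : FreeLieAlgebra ℂ I →ₗ⁅ℂ⁆ M := FreeLieAlgebra.lift ℂ x
  have hf : ∀ i, f (FreeLieAlgebra.of ℂ i) = x i := fun i => FreeLieAlgebra.lift_of_apply x i
  have hle : edgeIdeal A b ≤ f.ker := by
    rw [edgeIdeal, LieSubmodule.lieSpan_le]
    rintro _ ⟨i, j, hij, rfl⟩
    rw [SetLike.mem_coe, LieHom.mem_ker, map_edgeRelator]
    simp only [hf]
    exact h i j hij
  refine ⟨{ (edgeIdeal A b).toSubmodule.liftQ (f : FreeLieAlgebra ℂ I →ₗ[ℂ] M) hle with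
    map_lie' := fun {a c} => ?_ }, hf⟩
  obtain ⟨a, rfl⟩ := edgeMk_surjective A b a
  obtain ⟨c, rfl⟩ := edgeMk_surjective A b c
  rw [← LieHom.map_lie]
  exact f.map_lie a c

theorem serreExpr_of_zero {x : I → M} {i j : I} (h : A i j = 0) :
    serreExpr A b x i j = ⁅x i, x j⁆ := by
  simp [serreExpr, h]

theorem serreExpr_of_neg_one {x : I → M} {i j : I} (h : A i j = -1) :
    serreExpr A b x i j = ⁅x i, ⁅x i, x j⁆⁆ + (2 * b i j) • x i := by
  simp [serreExpr, h, pow_succ]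

theorem serreExpr_of_neg_two {x : I → M} {i j : I} (h : A i j = -2) :
    serreExpr A b x i j = ⁅x i, ⁅x i, ⁅x i, x j⁆⁆⁆ := by
  simp [serreExpr, h, pow_succ]

end Presentation

/-! ### The relations read off from the Cartan matrices -/

section CartanTypes

theorem cartanB_apply {n : ℕ} (i j : Fin n) : cartanB n i j =
    if j = i then 2 else if j.val + 1 = i.val then (if i.val = n - 1 then -2 else -1)
    else if i.val + 1 = j.val then -1 else 0 := rfl

theorem cartanC_apply {n : ℕ} (i j : Fin n) : cartanC n i j =
    if j = i then 2 else if j.val + 1 = i.val then -1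
    else if i.val + 1 = j.val then (if j.val = n - 1 then -2 else -1) else 0 := rfl

variable {M : Type*} [LieRing M] [LieAlgebra ℂ M] {l : ℕ} {b : Fin (l + 1) → Fin (l + 1) → ℂ}
  {β : ℕ → ℂ} {x : ℕ → M}

/-- One direction shows that the images in `so_{2n+1}` satisfy the presentation; the other shows
that the abstract generators satisfy `RelB`. -/
theorem relB_iff (hb : ∀ i j, b i j = b j i)
    (hβ : ∀ i (h : i + 1 < l + 1), β i = b ⟨i, by omega⟩ ⟨i + 1, h⟩) :
    RelB l β x ↔ ∀ i j : Fin (l + 1), i ≠ j →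
      serreExpr (cartanB (l + 1)) b (fun i => x i) i j = 0 := by
  constructor
  · intro h i j hij
    obtain ⟨i, hi⟩ := i
    obtain ⟨j, hj⟩ := j
    rw [Ne, Fin.mk.injEq] at hij
    rcases (by omega : i + 2 ≤ j ∨ j + 2 ≤ i ∨ j = i + 1 ∨ i = j + 1) with h' | h' | rfl | rfl
    · rw [serreExpr_of_zero (by simp [cartanB_apply]; omega)]
      exact h.comm i j h' (by omega)
    · rw [serreExpr_of_zero (by simp [cartanB_apply]; omega), ← lie_skew]
      exact neg_eq_zero.mpr (h.comm j i h' (by omega))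
    · rw [serreExpr_of_neg_one (by simp [cartanB_apply]; omega), ← hβ i hj]
      have : ⁅x i, ⁅x i, x (i + 1)⁆⁆ = (-(2 * β i)) • x i := by
        rcases (by omega : i + 2 ≤ l ∨ i + 1 = l) with h' | h'
        · exact h.up i h'
        · exact h.up_last i h'
      simp only [this]
      module
    · rcases (by omega : j + 2 ≤ l ∨ j + 1 = l) with h' | h'
      · rw [serreExpr_of_neg_one (by simp [cartanB_apply]; omega), hb, ← hβ j hi]
        simp only [h.down j h']
        module
      · rw [serreExpr_of_neg_two (by simp [cartanB_apply]; omega)]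
        exact h.cube j h'
  · intro h
    have hup : ∀ i, i + 1 ≤ l → ⁅x i, ⁅x i, x (i + 1)⁆⁆ = (-(2 * β i)) • x i := fun i hi => by
      have := h ⟨i, by omega⟩ ⟨i + 1, by omega⟩ (by simp)
      rw [serreExpr_of_neg_one (by simp [cartanB_apply]; omega), ← hβ i (by omega)] at this
      rw [neg_smul]
      exact eq_neg_of_add_eq_zero_left this
    refine { comm := ?_, up := fun i hi => hup i (by omega), down := ?_,
             up_last := fun i hi => hup i hi.le, cube := ?_ }
    · intro i j hij hj
      have := h ⟨i, by omega⟩ ⟨j, by omega⟩ (by rw [Ne, Fin.mk.injEq]; omega)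
      rwa [serreExpr_of_zero (by simp [cartanB_apply]; omega)] at this
    · intro i hi
      have := h ⟨i + 1, by omega⟩ ⟨i, by omega⟩ (by simp)
      rw [serreExpr_of_neg_one (by simp [cartanB_apply]; omega), hb, ← hβ i (by omega)] at this
      rw [neg_smul]
      exact eq_neg_of_add_eq_zero_left this
    · intro i hi
      have := h ⟨i + 1, by omega⟩ ⟨i, by omega⟩ (by simp)
      rwa [serreExpr_of_neg_two (by simp [cartanB_apply]; omega)] at this

theorem relC_iff (hb : ∀ i j, b i j = b j i)
    (hβ : ∀ i (h : i + 1 < l + 1), β i = b ⟨i, by omega⟩ ⟨i + 1, h⟩) :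
    RelC l β x ↔ ∀ i j : Fin (l + 1), i ≠ j →
      serreExpr (cartanC (l + 1)) b (fun i => x i) i j = 0 := by
  constructor
  · intro h i j hij
    obtain ⟨i, hi⟩ := i
    obtain ⟨j, hj⟩ := j
    rw [Ne, Fin.mk.injEq] at hij
    rcases (by omega : i + 2 ≤ j ∨ j + 2 ≤ i ∨ j = i + 1 ∨ i = j + 1) with h' | h' | rfl | rfl
    · rw [serreExpr_of_zero (by simp [cartanC_apply]; omega)]
      exact h.comm i j h' (by omega)
    · rw [serreExpr_of_zero (by simp [cartanC_apply]; omega), ← lie_skew]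
      exact neg_eq_zero.mpr (h.comm j i h' (by omega))
    · rcases (by omega : i + 2 ≤ l ∨ i + 1 = l) with h' | h'
      · rw [serreExpr_of_neg_one (by simp [cartanC_apply]; omega), ← hβ i hj]
        simp only [h.up i h']
        module
      · rw [serreExpr_of_neg_two (by simp [cartanC_apply]; omega)]
        exact h.cube i h'
    · rw [serreExpr_of_neg_one (by simp [cartanC_apply]), hb, ← hβ j hi]
      have : ⁅x (j + 1), ⁅x (j + 1), x j⁆⁆ = (-(2 * β j)) • x (j + 1) := by
        rcases (by omega : j + 2 ≤ l ∨ j + 1 = l) with h' | h'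
        · exact h.down j h'
        · exact h.down_last j h'
      simp only [this]
      module
  · intro h
    have hdown : ∀ i, i + 1 ≤ l → ⁅x (i + 1), ⁅x (i + 1), x i⁆⁆ = (-(2 * β i)) • x (i + 1) :=
      fun i hi => by
        have := h ⟨i + 1, by omega⟩ ⟨i, by omega⟩ (by simp)
        rw [serreExpr_of_neg_one (by simp [cartanC_apply]), hb, ← hβ i (by omega)] at this
        rw [neg_smul]
        exact eq_neg_of_add_eq_zero_left this
    refine { comm := ?_, up := ?_, down := fun i hi => hdown i (by omega),
             down_last := fun i hi => hdown i hi.le, cube := ?_ }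
    · intro i j hij hj
      have := h ⟨i, by omega⟩ ⟨j, by omega⟩ (by rw [Ne, Fin.mk.injEq]; omega)
      rwa [serreExpr_of_zero (by simp [cartanC_apply]; omega)] at this
    · intro i hi
      have := h ⟨i, by omega⟩ ⟨i + 1, by omega⟩ (by simp)
      rw [serreExpr_of_neg_one (by simp [cartanC_apply]; omega), ← hβ i (by omega)] at this
      rw [neg_smul]
      exact eq_neg_of_add_eq_zero_left this
    · intro i hi
      have := h ⟨i, by omega⟩ ⟨i + 1, by omega⟩ (by simp)
      rwa [serreExpr_of_neg_two (by simp [cartanC_apply]; omega)] at this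

variable {M' : Type*} [LieRing M'] [LieAlgebra ℂ M']

theorem RelA.of_injective {f : M →ₗ⁅ℂ⁆ M'} (hf : Function.Injective f)
    (h : RelA l β fun i => f (x i)) : RelA l β x where
  comm i j hij hj := hf (by simpa using h.comm i j hij hj)
  up i hi := hf (by simpa using h.up i hi)
  down i hi := hf (by simpa using h.down i hi)

theorem RelB.of_injective {f : M →ₗ⁅ℂ⁆ M'} (hf : Function.Injective f)
    (h : RelB l β fun i => f (x i)) : RelB l β x where
  toRelA := h.toRelA.of_injective hf
  up_last i hi := hf (by simpa using h.up_last i hi)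
  cube i hi := hf (by simpa using h.cube i hi)

theorem RelC.of_injective {f : M →ₗ⁅ℂ⁆ M'} (hf : Function.Injective f)
    (h : RelC l β fun i => f (x i)) : RelC l β x where
  toRelA := h.toRelA.of_injective hf
  down_last i hi := hf (by simpa using h.down_last i hi)
  cube i hi := hf (by simpa using h.cube i hi)

/-- A family indexed by `Fin n`, extended by zero. -/
def extendZero {n : ℕ} (x : Fin n → M) (i : ℕ) : M := if h : i < n then x ⟨i, h⟩ else 0

omit [LieAlgebra ℂ M] in
theorem extendZero_val {n : ℕ} (x : Fin n → M) (i : Fin n) : extendZero x i = x i :=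
  dif_pos i.2

omit [LieAlgebra ℂ M] in
theorem extendZero_of_le {n : ℕ} (x : Fin n → M) {i : ℕ} (h : n ≤ i) : extendZero x i = 0 :=
  dif_neg (by omega)

theorem lieSpan_range_extendZero {n : ℕ} {x : Fin n → M}
    (h : LieSubalgebra.lieSpan ℂ M (Set.range x) = ⊤) :
    LieSubalgebra.lieSpan ℂ M (Set.range (extendZero x)) = ⊤ := by
  rw [← top_le_iff, ← h]
  refine LieSubalgebra.lieSpan_mono ?_
  rintro _ ⟨i, rfl⟩
  exact ⟨i, extendZero_val x i⟩

end CartanTypes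

/-! ### The images inside the orthogonal and symplectic Lie algebras -/

section Targets

theorem single_eq_unitAt {m : Type*} [DecidableEq m] {code : m → ℤ}
    (hc : Function.Injective code) (x y : m) (c : ℂ) :
    Matrix.single x y c = c • unitAt code (code x) (code y) := by
  ext i j
  simp [unitAt, Matrix.single_apply, hc.eq_iff, eq_comm]

theorem soEMatrix_eq {n : ℕ} (i : Fin n) : soEMatrix i =
    if i.val + 1 < n then rootAt (codeB n) (i.val + 2) (i.val + 3)
    else (2 : ℂ) • unitAt (codeB n) (i.val + 2) 0 - unitAt (codeB n) 0 (-(i.val + 2)) := by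
  unfold soEMatrix
  split_ifs <;>
    simp only [single_eq_unitAt (codeB_injective n), codeB_v, codeB_w, codeB_zero, one_smul, rootAt,
      Nat.cast_add, Nat.cast_one, Nat.cast_ofNat, add_assoc, Int.reduceAdd]

theorem soFMatrix_eq {n : ℕ} {i : Fin n} (h : i.val + 1 < n) :
    soFMatrix i = rootAt (codeB n) (i.val + 3) (i.val + 2) := by
  unfold soFMatrix
  rw [dif_pos h]
  simp only [single_eq_unitAt (codeB_injective n), codeB_v, codeB_w, one_smul, rootAt,
    Nat.cast_add, Nat.cast_one, add_assoc, Int.reduceAdd]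

theorem spEMatrix_eq {n : ℕ} (i : Fin n) : spEMatrix i =
    if i.val + 1 < n then rootAt (codeC n) (i.val + 2) (i.val + 3)
    else unitAt (codeC n) (i.val + 2) (-(i.val + 2)) := by
  unfold spEMatrix
  split_ifs <;>
    simp only [single_eq_unitAt (codeC_injective n), codeC_v, codeC_w, one_smul, rootAt,
      Nat.cast_add, Nat.cast_one, Nat.cast_ofNat, add_assoc, Int.reduceAdd]

theorem spFMatrix_eq {n : ℕ} (i : Fin n) : spFMatrix i =
    if i.val + 1 < n then rootAt (codeC n) (i.val + 3) (i.val + 2)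
    else unitAt (codeC n) (-(i.val + 2)) (i.val + 2) := by
  unfold spFMatrix
  split_ifs <;>
    simp only [single_eq_unitAt (codeC_injective n), codeC_v, codeC_w, one_smul, rootAt,
      Nat.cast_add, Nat.cast_one, Nat.cast_ofNat, add_assoc, Int.reduceAdd]

variable {l : ℕ} (b : Fin (l + 1) → Fin (l + 1) → ℂ)

/-- The parameters of the edges `{i, i + 1}`. -/
def edgeParam (i : ℕ) : ℂ := if h : i + 1 < l + 1 then b ⟨i, by omega⟩ ⟨i + 1, h⟩ else 0

/-- The image of `u_i` in `so_{2n+1}`. -/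
noncomputable def soImage (i : Fin (l + 1)) : LieAlgebra.Orthogonal.typeB (Fin (l + 1)) ℂ :=
  if i.val = 0 then soE i else soE i + b ⟨i.val - 1, by omega⟩ i • soF ⟨i.val - 1, by omega⟩

/-- The image of `u_i` in `sp_{2n}`. -/
noncomputable def spImage (i : Fin (l + 1)) : LieAlgebra.Symplectic.sp (Fin (l + 1)) ℂ :=
  if i.val = 0 then spE i
  else if i.val + 1 < l + 1 then spE i + b ⟨i.val - 1, by omega⟩ i • spF ⟨i.val - 1, by omega⟩
  else spE i + (b i ⟨i.val - 1, by omega⟩ / 2) • spF ⟨i.val - 1, by omega⟩ -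
    ((1 / 2 : ℂ) * (b i ⟨i.val - 1, by omega⟩ / 2) ^ 2) •
      ⁅spF (n := l + 1) ⟨i.val - 1, by omega⟩, ⁅spF (n := l + 1) ⟨i.val - 1, by omega⟩, spF i⁆⁆

theorem coe_soImage (i : Fin (l + 1)) :
    (soImage b i : Matrix _ _ ℂ) = soGen (l + 1) (edgeParam b) i := by
  obtain ⟨i, hi⟩ := i
  cases i with
  | zero =>
    rw [soImage, if_pos rfl]
    change soEMatrix _ = _
    rw [soEMatrix_eq, soGen]
    split_ifs <;> simp_all [rootAt_codeB_one]
  | succ i =>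
    rw [soImage, if_neg (by simp)]
    change soEMatrix _ + b _ _ • soFMatrix _ = _
    rw [soEMatrix_eq, soFMatrix_eq (by simpa using hi), soGen]
    have hb : edgeParam b i = b ⟨i, by omega⟩ ⟨i + 1, hi⟩ := dif_pos hi
    simp only [Nat.add_sub_cancel, hb]
    push_cast
    simp only [add_assoc, Int.reduceAdd]
    split_ifs <;> first | rfl | omega

/-- The factor 2 cancels the `1 / 2` in `spImage`, which leaves the coefficient of the correction
term in `spGen`. -/
theorem lie_lie_spFMatrix {i : ℕ} (hi : i + 1 = l) :
    ⁅rootAt (codeC (l + 1)) (i + 3) (i + 2), ⁅rootAt (codeC (l + 1)) (i + 3) (i + 2),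
      unitAt (codeC (l + 1)) (-(i + 3)) (i + 3)⁆⁆ =
      (2 : ℂ) • unitAt (codeC (l + 1)) (-(i + 2)) (i + 2) := by
  simp (disch := omega) only [rootAt, Ring.lie_def, mul_add, add_mul, mul_sub, sub_mul,
    unitAtC_mul, unitAt_mul_of_ne, sub_zero, zero_sub, add_zero, zero_add, mul_zero, zero_mul,
    neg_zero, neg_mul, mul_neg, sub_self]
  module

theorem coe_spImage (hb : ∀ i j, b i j = b j i) (i : Fin (l + 1)) :
    (spImage b i : Matrix _ _ ℂ) = spGen (l + 1) (edgeParam b) i := by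
  obtain ⟨i, hi⟩ := i
  cases i with
  | zero =>
    rw [spImage, if_pos rfl]
    change spEMatrix _ = _
    rw [spEMatrix_eq, spGen]
    -- For `i = 0` truncated subtraction leaves `β 0` in `spGen`, even when this generator is also
    -- the last. It is harmless since no basis vector has code `±1`.
    have : unitAt (codeC (l + 1)) (-1) 1 = 0 := by
      ext x y
      have hx := codeC_range x
      exact unitAt_apply_of_not (by omega)
    split_ifs <;> simp_all [rootAt_codeC_one]
  | succ i =>
    have hβ : edgeParam b i = b ⟨i, by omega⟩ ⟨i + 1, hi⟩ := dif_pos hi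
    rw [spImage, if_neg (by simp)]
    by_cases hil : i + 1 + 1 < l + 1
    · rw [if_pos hil]
      change spEMatrix _ + b _ _ • spFMatrix _ = _
      rw [spEMatrix_eq, spFMatrix_eq, spGen, if_pos hil, if_pos hil, if_pos (by simpa using hi)]
      simp only [Nat.add_sub_cancel, hβ]
      push_cast
      simp only [add_assoc, Int.reduceAdd]
    · rw [if_neg hil]
      change spEMatrix _ + (b _ _ / 2) • spFMatrix _ - ((1 / 2 : ℂ) * (b _ _ / 2) ^ 2) •
        ⁅spFMatrix _, ⁅spFMatrix _, spFMatrix _⁆⁆ = _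
      rw [spEMatrix_eq, spFMatrix_eq, spFMatrix_eq, spGen, if_neg hil, if_neg hil, if_neg hil,
        if_pos (by simpa using hi), if_pos (show i + 1 + 1 = l + 1 by omega)]
      have key := lie_lie_spFMatrix (l := l) (i := i) (by omega)
      simp only [Nat.add_sub_cancel, hβ]
      push_cast
      simp only [add_assoc, Int.reduceAdd]
      rw [key, hb]
      module

theorem sp_symm {n : ℕ} {X : Matrix (Fin n ⊕ Fin n) (Fin n ⊕ Fin n) ℂ}
    (hX : X ∈ LieAlgebra.Symplectic.sp (Fin n) ℂ) (i j : Fin n) :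
    X (Sum.inl i) (Sum.inr j) = X (Sum.inl j) (Sum.inr i) := by
  rw [LieAlgebra.Symplectic.sp, mem_skewAdjointMatricesLieSubalgebra,
    mem_skewAdjointMatricesSubmodule] at hX
  have := congrFun (congrFun hX (Sum.inr i)) (Sum.inr j)
  simp [Matrix.J, Matrix.mul_apply, Matrix.one_apply] at this
  exact this.symm

theorem exists_injective_so (hb : ∀ i j, b i j = b j i) :
    ∃ φ : EdgeAlgebra (cartanB (l + 1)) b →ₗ⁅ℂ⁆ LieAlgebra.Orthogonal.typeB (Fin (l + 1)) ℂ,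
      (∀ i, φ (EdgeAlgebra.u _ b i) = soImage b i) ∧ Function.Injective φ := by
  have hβ : ∀ i (h : i + 1 < l + 1), edgeParam b i = b ⟨i, by omega⟩ ⟨i + 1, h⟩ :=
    fun i h => dif_pos h
  set K := LieAlgebra.Orthogonal.typeB (Fin (l + 1)) ℂ
  have himg : ∀ i, K.incl (extendZero (soImage b) i) = soGen (l + 1) (edgeParam b) i := by
    intro i
    rcases Nat.lt_or_ge i (l + 1) with hi | hi
    · rw [← coe_soImage b ⟨i, hi⟩, ← extendZero_val (soImage b) ⟨i, hi⟩]
      rfl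
    · rw [extendZero_of_le _ hi, map_zero, soGen, if_neg (by omega), if_neg (by omega)]
  have hrel : RelB l (edgeParam b) (extendZero (soImage b)) := by
    refine RelB.of_injective (f := K.incl) Subtype.val_injective ?_
    simp only [himg]
    exact relB_soGen l _
  have hserre := (relB_iff hb hβ).mp hrel
  simp only [extendZero_val] at hserre
  obtain ⟨φ, hφ⟩ := exists_edgeLift _ hserre
  refine ⟨φ, hφ, ?_⟩
  have hrel' : RelB l (edgeParam b) (extendZero (EdgeAlgebra.u (cartanB (l + 1)) b)) := by
    refine (relB_iff hb hβ).mpr fun i j hij => ?_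
    simp only [extendZero_val]
    exact serreExpr_u hij
  have hinj := hrel'.injective l (fun i hi => extendZero_of_le _ hi)
    (lieSpan_range_extendZero (lieSpan_range_u _ b)) (Φ := K.incl.comp φ) fun i => by
      rw [← himg, LieHom.comp_apply]
      congr 1
      unfold extendZero
      split_ifs
      · exact hφ _
      · exact map_zero φ
  exact Function.Injective.of_comp (f := K.incl) (by simpa using hinj)

theorem exists_injective_sp (hb : ∀ i j, b i j = b j i) :
    ∃ φ : EdgeAlgebra (cartanC (l + 1)) b →ₗ⁅ℂ⁆ LieAlgebra.Symplectic.sp (Fin (l + 1)) ℂ,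
      (∀ i, φ (EdgeAlgebra.u _ b i) = spImage b i) ∧ Function.Injective φ := by
  have hβ : ∀ i (h : i + 1 < l + 1), edgeParam b i = b ⟨i, by omega⟩ ⟨i + 1, h⟩ :=
    fun i h => dif_pos h
  set K := LieAlgebra.Symplectic.sp (Fin (l + 1)) ℂ
  have himg : ∀ i, K.incl (extendZero (spImage b) i) = spGen (l + 1) (edgeParam b) i := by
    intro i
    rcases Nat.lt_or_ge i (l + 1) with hi | hi
    · rw [← coe_spImage b hb ⟨i, hi⟩, ← extendZero_val (spImage b) ⟨i, hi⟩]
      rfl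
    · rw [extendZero_of_le _ hi, map_zero, spGen, if_neg (by omega), if_neg (by omega)]
  have hrel : RelC l (edgeParam b) (extendZero (spImage b)) := by
    refine RelC.of_injective (f := K.incl) Subtype.val_injective ?_
    simp only [himg]
    exact relC_spGen l _
  have hserre := (relC_iff hb hβ).mp hrel
  simp only [extendZero_val] at hserre
  obtain ⟨φ, hφ⟩ := exists_edgeLift _ hserre
  refine ⟨φ, hφ, ?_⟩
  have hrel' : RelC l (edgeParam b) (extendZero (EdgeAlgebra.u (cartanC (l + 1)) b)) := by
    refine (relC_iff hb hβ).mpr fun i j hij => ?_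
    simp only [extendZero_val]
    exact serreExpr_u hij
  have hinj := hrel'.injective l (fun i hi => extendZero_of_le _ hi)
    (lieSpan_range_extendZero (lieSpan_range_u _ b)) (Φ := K.incl.comp φ) (fun i => by
      rw [← himg, LieHom.comp_apply]
      congr 1
      unfold extendZero
      split_ifs
      · exact hφ _
      · exact map_zero φ) fun x i j => sp_symm (φ x).2 i j
  exact Function.Injective.of_comp (f := K.incl) (by simpa using hinj)

theorem subsingleton_edgeAlgebra {I : Type} [IsEmpty I] (A : Matrix I I ℤ) (b : I → I → ℂ) :
    Subsingleton (EdgeAlgebra A b) := by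
  have h := lieSpan_range_u A b
  rw [Set.range_eq_empty, LieSubalgebra.span_empty] at h
  refine subsingleton_of_forall_eq 0 fun x => ?_
  have hx : x ∈ (⊤ : LieSubalgebra ℂ (EdgeAlgebra A b)) := LieSubalgebra.mem_top x
  rwa [← h, LieSubalgebra.mem_bot] at hx

end Targets

end ElectricalLie

theorem mainTheorem6 (n : ℕ) (b : Fin n → Fin n → ℂ) (hb : ∀ i j, b i j = b j i) :
    (∃ φ : ElectricalLie.EdgeAlgebra (ElectricalLie.cartanB n) b →ₗ⁅ℂ⁆
          LieAlgebra.Orthogonal.typeB (Fin n) ℂ,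
        (∀ i : Fin n, i.val = 0 →
          φ (ElectricalLie.EdgeAlgebra.u (ElectricalLie.cartanB n) b i) = ElectricalLie.soE i) ∧
        (∀ i j : Fin n, j.val + 1 = i.val →
          φ (ElectricalLie.EdgeAlgebra.u (ElectricalLie.cartanB n) b i) =
            ElectricalLie.soE i + b j i • ElectricalLie.soF j) ∧
        Function.Injective φ) ∧
    (∃ φ : ElectricalLie.EdgeAlgebra (ElectricalLie.cartanC n) b →ₗ⁅ℂ⁆
          LieAlgebra.Symplectic.sp (Fin n) ℂ,
        (∀ i : Fin n, i.val = 0 →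
          φ (ElectricalLie.EdgeAlgebra.u (ElectricalLie.cartanC n) b i) = ElectricalLie.spE i) ∧
        (∀ i j : Fin n, j.val + 1 = i.val → i.val + 1 < n →
          φ (ElectricalLie.EdgeAlgebra.u (ElectricalLie.cartanC n) b i) =
            ElectricalLie.spE i + b j i • ElectricalLie.spF j) ∧
        (∀ i j : Fin n, j.val + 1 = i.val → i.val + 1 = n →
          φ (ElectricalLie.EdgeAlgebra.u (ElectricalLie.cartanC n) b i) =
            ElectricalLie.spE i + (b i j / 2) • ElectricalLie.spF j -
              ((1 / 2 : ℂ) * (b i j / 2) ^ 2) •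
                ⁅ElectricalLie.spF j, ⁅ElectricalLie.spF j, ElectricalLie.spF i⁆⁆) ∧
        Function.Injective φ) := by
  cases n with
  | zero =>
    have := ElectricalLie.subsingleton_edgeAlgebra (ElectricalLie.cartanB 0) b
    have := ElectricalLie.subsingleton_edgeAlgebra (ElectricalLie.cartanC 0) b
    exact ⟨⟨0, fun i => i.elim0, fun i => i.elim0, Function.injective_of_subsingleton _⟩,
      ⟨0, fun i => i.elim0, fun i => i.elim0, fun i => i.elim0,
        Function.injective_of_subsingleton _⟩⟩
  | succ l =>
    obtain ⟨φ, hφ, hφi⟩ := ElectricalLie.exists_injective_so b hb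
    obtain ⟨ψ, hψ, hψi⟩ := ElectricalLie.exists_injective_sp b hb
    refine ⟨⟨φ, fun i hi => ?_, fun i j hij => ?_, hφi⟩,
      ⟨ψ, fun i hi => ?_, fun i j hij hil => ?_, fun i j hij hil => ?_, hψi⟩⟩
    · rw [hφ, ElectricalLie.soImage, if_pos hi]
    · have hj : (⟨i.val - 1, by omega⟩ : Fin (l + 1)) = j := Fin.ext (Nat.sub_eq_of_eq_add hij.symm)
      rw [hφ, ElectricalLie.soImage, if_neg (show ¬ i.val = 0 by omega), hj]
    · rw [hψ, ElectricalLie.spImage, if_pos hi]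
    · have hj : (⟨i.val - 1, by omega⟩ : Fin (l + 1)) = j := Fin.ext (Nat.sub_eq_of_eq_add hij.symm)
      rw [hψ, ElectricalLie.spImage, if_neg (show ¬ i.val = 0 by omega), if_pos hil, hj]
    · have hj : (⟨i.val - 1, by omega⟩ : Fin (l + 1)) = j := Fin.ext (Nat.sub_eq_of_eq_add hij.symm)
      rw [hψ, ElectricalLie.spImage, if_neg (show ¬ i.val = 0 by omega),
        if_neg (show ¬ i.val + 1 < l + 1 by omega), hj]
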